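/- Let $A$ be an associative ring with unit and let $\mathcal{C}$ be an $A$-coring, with comultiplication $\Delta$ and counit $\varepsilon$. Write $[\mathcal{C},-]={\rm Hom}_A(\mathcal{C},-)$ for the induced monad on the category $\mathbb{M}_A$ of right $A$-modules, where $(fa)(c)=f(ac)$ for $f\in[\mathcal{C},X]$, $a\in A$, $c\in\mathcal{C}$; its unit is $x\mapsto[c\mapsto x\,\varepsilon(c)]$ and its multiplication is $[\mathcal{C},[\mathcal{C},X]]\cong[\mathcal{C}\otimes_A\mathcal{C},X]\to[\mathcal{C},X]$, the last map being composition with $\Delta$. Let $\mathbb{M}_{[\mathcal{C},-]}$ be the category of modules over this monad (right $\mathcal{C}$-contramodules). Let $(N,{}^N\!\varrho)$ be a left $\mathcal{C}$-comodule, let $T={\rm End}^{\mathcal{C}}(N)$ be its ring of comodule endomorphisms, acting on $N$ from the right, and let $B\subset T$ be a subring. Assume that $N$ is $[\mathcal{C},-]$-Galois as a $(\mathcal{C},B)$-bicomodule (with $B$ the trivial $B$-coring), that is, for every right $A$-module $X$ the canonical map $$[\mathcal{C},X]\longrightarrow {\rm Hom}_B(N,X\otimes_A N),\qquad f\mapsto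 (f\otimes_A N)\circ{}^N\!\varrho,$$ is bijective. Assume moreover that $N$ is a projective generator in the category $\mathbb{M}_B$ of right $B$-modules. For $(M,\alpha_M)\in\mathbb{M}_{[\mathcal{C},-]}$ let the contratensor product $M\otimes_{[\mathcal{C},-]}N$ be the coequaliser in $\mathbb{M}_B$ of the two maps $[\mathcal{C},M]\otimes_A N\to M\otimes_A N$ given by $f\otimes n\mapsto (f\otimes_A N)({}^N\!\varrho(n))$ and $f\otimes n\mapsto\alpha_M(f)\otimes n$. Then: 1. The functor $-\otimes_{[\mathcal{C},-]}N:\mathbb{M}_{[\mathcal{C},-]}\to\mathbb{M}_B$ is an equivalence. 2. $\mathcal{C}$ is a projective right $A$-module. 3. $N$ is a finitely generated and projective left $A$-module. 4. $\mathcal{C}$ is isomorphic, as an $A$-coring, to the comatrix coring $N\otimes_B{}^*N$, where ${}^*N={\rm Hom}_{A,-}(N,A)$ is the left dual; its coring structure is $\Delta(n\otimes f)=\sum_i (n\otimes e_i^*)\otimes_A(e_i\otimes f)$ and $\varepsilon(n\otimes f)=f(n)$, for any finite dual basis $(e_i,e_i^*)$ of the left $A$-module $N$. 5. $B$ is isomorphic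 to $T$; more precisely, the inclusion $B\to T$ is an isomorphism. 6. If, in addition, $\mathcal{C}$ is a generator of the category of right $A$-modules, then $N$ is a faithfully flat left $A$-module. -/

import Mathlib

/-!
Right modules over a ring `A` are `Aᵐᵒᵖ`-modules: `x · a` is written `MulOpposite.op a • x`.
All rings are associative and unital, not necessarily commutative.
-/

open CategoryTheory MulOpposite
open scoped TensorProduct

set_option linter.unusedVariables false
set_option linter.unusedSectionVars false

universe u

namespace ContraGalois

section Tensor

variable (A : Type*) [Ring A]
variable (M : Type*) [AddCommGroup M] [Module Aᵐᵒᵖ M]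
variable (N : Type*) [AddCommGroup N] [Module A N]

/-- The additive subgroup of `M ⊗[ℤ] N` generated by the elements `m a ⊗ n - m ⊗ a n`. -/
def balancedRel : AddSubgroup (M ⊗[ℤ] N) :=
  AddSubgroup.closure
    {t | ∃ (m : M) (a : A) (n : N), t = (op a • m) ⊗ₜ[ℤ] n - m ⊗ₜ[ℤ] (a • n)}

/-- The tensor product `M ⊗_A N` of a right `A`-module `M` and a left `A`-module `N` over a
(not necessarily commutative) ring `A`, as an abelian group. -/
def BTensor : Type _ := (M ⊗[ℤ] N) ⧸ balancedRel A M N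

instance : AddCommGroup (BTensor A M N) :=
  inferInstanceAs (AddCommGroup ((M ⊗[ℤ] N) ⧸ balancedRel A M N))

end Tensor

namespace BTensor

section Basic

variable {A : Type*} [Ring A]
variable {M : Type*} [AddCommGroup M] [Module Aᵐᵒᵖ M]
variable {N : Type*} [AddCommGroup N] [Module A N]
variable {P : Type*} [AddCommGroup P]

variable (A M N) in
/-- The projection `M ⊗[ℤ] N → M ⊗_A N`. -/
def proj : M ⊗[ℤ] N →+ BTensor A M N :=
  QuotientAddGroup.mk' (balancedRel A M N)

variable (A) in
/-- The element `m ⊗ n` of `M ⊗_A N`. -/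
def tmul (m : M) (n : N) : BTensor A M N := proj A M N (m ⊗ₜ[ℤ] n)

theorem add_tmul (m m' : M) (n : N) : tmul A (m + m') n = tmul A m n + tmul A m' n := by
  simp only [tmul, TensorProduct.add_tmul, map_add]

theorem tmul_add (m : M) (n n' : N) : tmul A m (n + n') = tmul A m n + tmul A m n' := by
  simp only [tmul, TensorProduct.tmul_add, map_add]

theorem balanced (m : M) (a : A) (n : N) : tmul A (op a • m) n = tmul A m (a • n) := by
  rw [← sub_eq_zero]
  simp only [tmul]
  rw [← map_sub]
  exact (QuotientAddGroup.eq_zero_iff _).2 (AddSubgroup.subset_closure ⟨m, a, n, rfl⟩)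

variable (A M N) in
/-- The universal biadditive map `M → N → M ⊗_A N`. -/
def mk : M →+ N →+ BTensor A M N :=
  AddMonoidHom.mk' (fun m => AddMonoidHom.mk' (tmul A m) (tmul_add m))
    (fun m m' => by ext n; exact add_tmul m m' n)

theorem mk_apply (m : M) (n : N) : mk A M N m n = tmul A m n := rfl

theorem tmul_sum {ι : Type*} (s : Finset ι) (m : M) (n : ι → N) :
    tmul A m (∑ i ∈ s, n i) = ∑ i ∈ s, tmul A m (n i) :=
  map_sum (mk A M N m) n s

theorem sum_tmul {ι : Type*} (s : Finset ι) (m : ι → M) (n : N) :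
    tmul A (∑ i ∈ s, m i) n = ∑ i ∈ s, tmul A (m i) n :=
  map_sum ((mk A M N).flip n) m s

@[elab_as_elim]
theorem induction_on {motive : BTensor A M N → Prop} (t : BTensor A M N)
    (zero : motive 0) (tmul : ∀ m n, motive (tmul A m n))
    (add : ∀ x y, motive x → motive y → motive (x + y)) : motive t := by
  obtain ⟨t, rfl⟩ : ∃ x, proj A M N x = t := QuotientAddGroup.mk'_surjective _ t
  induction t with
  | zero => rw [map_zero]; exact zero
  | tmul m n => exact tmul m n
  | add x y hx hy => rw [map_add]; exact add _ _ hx hy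

theorem hom_ext {f g : BTensor A M N →+ P} (h : ∀ m n, f (tmul A m n) = g (tmul A m n)) :
    f = g := by
  ext t
  induction t using induction_on with
  | zero => rw [map_zero, map_zero]
  | tmul m n => exact h m n
  | add x y hx hy => rw [map_add, map_add, hx, hy]

/-- The additive map out of `M ⊗_A N` induced by a balanced biadditive map. -/
def lift (f : M →+ N →+ P) (hf : ∀ m (a : A) n, f (op a • m) n = f m (a • n)) :
    BTensor A M N →+ P :=
  QuotientAddGroup.lift (balancedRel A M N)
    (TensorProduct.liftAddHom f (fun r m n => by simp)) (by
      rw [balancedRel, AddSubgroup.closure_le]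
      rintro _ ⟨m, a, n, rfl⟩
      simp [hf])

@[simp]
theorem lift_tmul (f : M →+ N →+ P) (hf : ∀ m (a : A) n, f (op a • m) n = f m (a • n))
    (m : M) (n : N) : lift f hf (tmul A m n) = f m n := rfl

end Basic

section Map

variable {A : Type*} [Ring A]
variable {M M' M'' : Type*} [AddCommGroup M] [Module Aᵐᵒᵖ M] [AddCommGroup M'] [Module Aᵐᵒᵖ M']
  [AddCommGroup M''] [Module Aᵐᵒᵖ M'']
variable {N N' N'' : Type*} [AddCommGroup N] [Module A N] [AddCommGroup N'] [Module A N']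
  [AddCommGroup N''] [Module A N'']

/-- The additive map `f ⊗_A g`. -/
def map (f : M →ₗ[Aᵐᵒᵖ] M') (g : N →ₗ[A] N') : BTensor A M N →+ BTensor A M' N' :=
  lift (((mk A M' N').comp f.toAddMonoidHom).compl₂ g.toAddMonoidHom) (by
    intro m a n
    change tmul A (f (op a • m)) (g n) = tmul A (f m) (g (a • n))
    rw [map_smul, map_smul, balanced])

@[simp]
theorem map_tmul (f : M →ₗ[Aᵐᵒᵖ] M') (g : N →ₗ[A] N') (m : M) (n : N) :
    map f g (tmul A m n) = tmul A (f m) (g n) := rfl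

theorem map_id (t : BTensor A M N) : map LinearMap.id LinearMap.id t = t := by
  induction t using induction_on with
  | zero => rw [map_zero]
  | tmul m n => rfl
  | add x y hx hy => rw [map_add, hx, hy]

theorem map_map (f' : M' →ₗ[Aᵐᵒᵖ] M'') (g' : N' →ₗ[A] N'') (f : M →ₗ[Aᵐᵒᵖ] M')
    (g : N →ₗ[A] N') (t : BTensor A M N) :
    map f' g' (map f g t) = map (f' ∘ₗ f) (g' ∘ₗ g) t := by
  induction t using induction_on with
  | zero => simp only [map_zero]
  | tmul m n => rfl
  | add x y hx hy => simp only [map_add, hx, hy]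

theorem map_add_left (f f' : M →ₗ[Aᵐᵒᵖ] M') (g : N →ₗ[A] N') (t : BTensor A M N) :
    map (f + f') g t = map f g t + map f' g t := by
  induction t using induction_on with
  | zero => simp only [map_zero, add_zero]
  | tmul m n => exact add_tmul _ _ _
  | add x y hx hy => simp only [map_add, hx, hy]; abel

theorem map_add_right (f : M →ₗ[Aᵐᵒᵖ] M') (g g' : N →ₗ[A] N') (t : BTensor A M N) :
    map f (g + g') t = map f g t + map f g' t := by
  induction t using induction_on with
  | zero => simp only [map_zero, add_zero]
  | tmul m n => exact tmul_add _ _ _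
  | add x y hx hy => simp only [map_add, hx, hy]; abel

theorem map_zero_left (g : N →ₗ[A] N') (t : BTensor A M N) :
    map (0 : M →ₗ[Aᵐᵒᵖ] M') g t = 0 := by
  induction t using induction_on with
  | zero => simp only [map_zero]
  | tmul m n => exact map_zero ((mk A M' N').flip (g n))
  | add x y hx hy => simp only [map_add, hx, hy, add_zero]

theorem map_zero_right (f : M →ₗ[Aᵐᵒᵖ] M') (t : BTensor A M N) :
    map f (0 : N →ₗ[A] N') t = 0 := by
  induction t using induction_on with
  | zero => simp only [map_zero]
  | tmul m n => exact map_zero (mk A M' N' (f m))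
  | add x y hx hy => simp only [map_add, hx, hy, add_zero]

end Map

section Actions

variable {A : Type*} [Ring A]
variable {M : Type*} [AddCommGroup M] [Module Aᵐᵒᵖ M]
variable {N : Type*} [AddCommGroup N] [Module A N]
variable {R : Type*} [Ring R] [Module R M] [SMulCommClass R Aᵐᵒᵖ M]
variable {S : Type*} [Ring S] [Module Sᵐᵒᵖ N] [SMulCommClass A Sᵐᵒᵖ N]

/-- Left multiplication by `r` on an `(R, A)`-bimodule, as a right `A`-linear map. -/
def leftMul (A : Type*) [Ring A] (M : Type*) [AddCommGroup M] [Module Aᵐᵒᵖ M]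
    {R : Type*} [Ring R] [Module R M] [SMulCommClass R Aᵐᵒᵖ M] (r : R) : M →ₗ[Aᵐᵒᵖ] M where
  toFun m := r • m
  map_add' := smul_add r
  map_smul' a m := smul_comm r a m

/-- Right multiplication by `s` on an `(A, S)`-bimodule, as a left `A`-linear map. -/
def rightMul (A : Type*) [Ring A] (N : Type*) [AddCommGroup N] [Module A N]
    {S : Type*} [Ring S] [Module Sᵐᵒᵖ N] [SMulCommClass A Sᵐᵒᵖ N] (s : Sᵐᵒᵖ) : N →ₗ[A] N where
  toFun n := s • n
  map_add' := smul_add s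
  map_smul' a n := (smul_comm a s n).symm

/-- If `M` is an `(R, A)`-bimodule then `M ⊗_A N` is a left `R`-module. -/
instance leftModule : Module R (BTensor A M N) where
  smul r t := map (leftMul A M r) LinearMap.id t
  smul_zero r := map_zero _
  smul_add r := map_add _
  one_smul t := by
    have h : leftMul A M (1 : R) = LinearMap.id := by ext m; exact one_smul R m
    change map (leftMul A M (1 : R)) LinearMap.id t = t
    rw [h, map_id]
  mul_smul r s t := by
    have h : leftMul A M (r * s) = leftMul A M r ∘ₗ leftMul A M s := by
      ext m; exact mul_smul r s m
    change map (leftMul A M (r * s)) LinearMap.id t =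
      map (leftMul A M r) LinearMap.id (map (leftMul A M s) LinearMap.id t)
    rw [h, map_map, LinearMap.id_comp]
  add_smul r s t := by
    have h : leftMul A M (r + s) = leftMul A M r + leftMul A M s := by
      ext m; exact add_smul r s m
    change map (leftMul A M (r + s)) LinearMap.id t = _
    rw [h, map_add_left]; rfl
  zero_smul t := by
    have h : leftMul A M (0 : R) = 0 := by ext m; exact zero_smul R m
    change map (leftMul A M (0 : R)) LinearMap.id t = 0
    rw [h, map_zero_left]

/-- If `N` is an `(A, S)`-bimodule then `M ⊗_A N` is a right `S`-module. -/
instance rightModule : Module Sᵐᵒᵖ (BTensor A M N) where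
  smul s t := map LinearMap.id (rightMul A N s) t
  smul_zero r := map_zero _
  smul_add r := map_add _
  one_smul t := by
    have h : rightMul A N (1 : Sᵐᵒᵖ) = LinearMap.id := by ext m; exact one_smul _ m
    change map LinearMap.id (rightMul A N (1 : Sᵐᵒᵖ)) t = t
    rw [h, map_id]
  mul_smul r s t := by
    have h : rightMul A N (r * s) = rightMul A N r ∘ₗ rightMul A N s := by
      ext m; exact mul_smul r s m
    change map LinearMap.id (rightMul A N (r * s)) t =
      map LinearMap.id (rightMul A N r) (map LinearMap.id (rightMul A N s) t)
    rw [h, map_map, LinearMap.id_comp]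
  add_smul r s t := by
    have h : rightMul A N (r + s) = rightMul A N r + rightMul A N s := by
      ext m; exact add_smul r s m
    change map LinearMap.id (rightMul A N (r + s)) t = _
    rw [h, map_add_right]; rfl
  zero_smul t := by
    have h : rightMul A N (0 : Sᵐᵒᵖ) = 0 := by ext m; exact zero_smul _ m
    change map LinearMap.id (rightMul A N (0 : Sᵐᵒᵖ)) t = 0
    rw [h, map_zero_right]

theorem smul_eq (r : R) (t : BTensor A M N) : r • t = map (leftMul A M r) LinearMap.id t := rfl

theorem op_smul_eq (s : Sᵐᵒᵖ) (t : BTensor A M N) :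
    s • t = map LinearMap.id (rightMul A N s) t := rfl

theorem smul_tmul (r : R) (m : M) (n : N) : r • tmul A m n = tmul A (r • m) n := rfl

theorem op_smul_tmul (s : Sᵐᵒᵖ) (m : M) (n : N) : s • tmul A m n = tmul A m (s • n) := rfl

instance : SMulCommClass R Sᵐᵒᵖ (BTensor A M N) where
  smul_comm r s t := by
    rw [smul_eq, op_smul_eq, smul_eq, op_smul_eq, map_map, map_map]
    rfl

/-- The canonical map `A ⊗_A N → N`, `a ⊗ n ↦ a n`. -/
def lid (A : Type*) [Ring A] (N : Type*) [AddCommGroup N] [Module A N] : BTensor A A N →+ N :=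
  lift (AddMonoidHom.mk' (fun a : A => DistribSMul.toAddMonoidHom N a)
    (fun a b => by ext n; exact add_smul a b n)) (by
      intro m a n
      change (m * a) • n = m • a • n
      exact mul_smul m a n)

@[simp]
theorem lid_tmul (a : A) (n : N) : lid A N (tmul A a n) = a • n := rfl

/-- The canonical map `M ⊗_A A → M`, `m ⊗ a ↦ m a`. -/
def rid (A : Type*) [Ring A] (M : Type*) [AddCommGroup M] [Module Aᵐᵒᵖ M] : BTensor A M A →+ M :=
  lift (AddMonoidHom.flip (AddMonoidHom.mk' (fun a : A => DistribSMul.toAddMonoidHom M (op a))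
    (fun a b => by ext n; exact add_smul (op a) (op b) n))) (by
      intro m a b
      change op b • op a • m = op (a * b) • m
      rw [op_mul, mul_smul])

@[simp]
theorem rid_tmul (m : M) (a : A) : rid A M (tmul A m a) = op a • m := rfl

/-- For `q ∈ Q`, the map `M ⊗_A P → M ⊗_A (P ⊗_B Q)`, `m ⊗ p ↦ m ⊗ (p ⊗ q)`. -/
def assocAux (A B : Type*) [Ring A] [Ring B] (M P : Type*) {Q : Type*} [AddCommGroup M]
    [AddCommGroup P] [AddCommGroup Q] [Module Aᵐᵒᵖ M] [Module A P] [Module Bᵐᵒᵖ P]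
    [SMulCommClass A Bᵐᵒᵖ P] [Module B Q] (q : Q) :
    BTensor A M P →+ BTensor A M (BTensor B P Q) :=
  map LinearMap.id
    { toFun := fun p => tmul B p q
      map_add' := fun p p' => add_tmul p p' q
      map_smul' := fun a p => rfl }

/-- The canonical map `(M ⊗_A P) ⊗_B Q → M ⊗_A (P ⊗_B Q)`, `(m ⊗ p) ⊗ q ↦ m ⊗ (p ⊗ q)`,
for an `(A, B)`-bimodule `P`. -/
def assoc (A B : Type*) [Ring A] [Ring B] (M P Q : Type*) [AddCommGroup M] [AddCommGroup P]
    [AddCommGroup Q] [Module Aᵐᵒᵖ M] [Module A P] [Module Bᵐᵒᵖ P] [SMulCommClass A Bᵐᵒᵖ P]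
    [Module B Q] : BTensor B (BTensor A M P) Q →+ BTensor A M (BTensor B P Q) :=
  lift (AddMonoidHom.flip (AddMonoidHom.mk' (fun q => assocAux A B M P q)
    (fun q q' => hom_ext fun m p => by
      rw [AddMonoidHom.add_apply]
      change tmul A m (tmul B p (q + q')) = tmul A m (tmul B p q) + tmul A m (tmul B p q')
      rw [tmul_add, tmul_add]))) (by
    intro t b q
    change assocAux A B M P q (op b • t) = assocAux A B M P (b • q) t
    induction t using induction_on with
    | zero => simp only [smul_zero, map_zero]
    | tmul m p => exact congrArg (tmul A m) (balanced p b q)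
    | add x y hx hy => simp only [smul_add, map_add, hx, hy])

@[simp]
theorem assoc_tmul {B : Type*} [Ring B] {P Q : Type*} [AddCommGroup P]
    [AddCommGroup Q] [Module A P] [Module Bᵐᵒᵖ P] [SMulCommClass A Bᵐᵒᵖ P]
    [Module B Q] (m : M) (p : P) (q : Q) :
    assoc A B M P Q (tmul B (tmul A m p) q) = tmul A m (tmul B p q) := rfl

/-- `f ⊗_A N`, as a right `S`-linear map, for a right `A`-linear map `f` and an
`(A, S)`-bimodule `N`. -/
def mapRight (S : Type*) [Ring S] {M M' : Type*} [AddCommGroup M] [Module Aᵐᵒᵖ M]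
    [AddCommGroup M'] [Module Aᵐᵒᵖ M'] (N : Type*) [AddCommGroup N] [Module A N]
    [Module Sᵐᵒᵖ N] [SMulCommClass A Sᵐᵒᵖ N] (f : M →ₗ[Aᵐᵒᵖ] M') :
    BTensor A M N →ₗ[Sᵐᵒᵖ] BTensor A M' N where
  toFun := map f LinearMap.id
  map_add' := map_add _
  map_smul' s t := by
    rw [RingHom.id_apply, op_smul_eq, op_smul_eq, map_map, map_map]
    rfl

end Actions

end BTensor

/-- Homomorphisms of `(A, B)`-bimodules. -/
structure BimodHom (A B : Type*) [Ring A] [Ring B] (M M' : Type*) [AddCommGroup M]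
    [AddCommGroup M'] [Module A M] [Module Bᵐᵒᵖ M] [Module A M'] [Module Bᵐᵒᵖ M']
    extends M →ₗ[A] M' where
  map_op_smul' : ∀ (b : Bᵐᵒᵖ) (m : M), toFun (b • m) = b • toFun m

namespace BimodHom

variable {A B : Type*} [Ring A] [Ring B] {M M' : Type*} [AddCommGroup M]
    [AddCommGroup M'] [Module A M] [Module Bᵐᵒᵖ M] [Module A M'] [Module Bᵐᵒᵖ M']

/-- The underlying left linear map. -/
abbrev left (f : BimodHom A B M M') : M →ₗ[A] M' := f.toLinearMap

/-- The underlying right linear map. -/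
def right (f : BimodHom A B M M') : M →ₗ[Bᵐᵒᵖ] M' where
  toFun := f.toLinearMap
  map_add' := map_add f.toLinearMap
  map_smul' := f.map_op_smul'

@[simp]
theorem right_apply (f : BimodHom A B M M') (m : M) : f.right m = f.left m := rfl

end BimodHom

/-- An `A`-coring structure on an `(A, A)`-bimodule `C`: bimodule maps `Δ : C → C ⊗_A C` and
`ε : C → A` that are coassociative and counital. -/
class Coring (A : Type*) [Ring A] (C : Type*) [AddCommGroup C] [Module A C] [Module Aᵐᵒᵖ C]
    [SMulCommClass A Aᵐᵒᵖ C] where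
  comul : BimodHom A A C (BTensor A C C)
  counit : BimodHom A A C A
  coassoc : ∀ c : C,
    BTensor.assoc A A C C C (BTensor.map comul.right LinearMap.id (comul.left c)) =
      BTensor.map LinearMap.id comul.left (comul.left c)
  counit_comul : ∀ c : C,
    BTensor.lid A C (BTensor.map counit.right LinearMap.id (comul.left c)) = c
  comul_counit : ∀ c : C,
    BTensor.rid A C (BTensor.map LinearMap.id counit.left (comul.left c)) = c

/-- Isomorphisms of `A`-corings. -/
structure CoringIso (A : Type*) [Ring A] (C D : Type*)
    [AddCommGroup C] [Module A C] [Module Aᵐᵒᵖ C] [SMulCommClass A Aᵐᵒᵖ C] [Coring A C]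
    [AddCommGroup D] [Module A D] [Module Aᵐᵒᵖ D] [SMulCommClass A Aᵐᵒᵖ D] [Coring A D]
    extends BimodHom A A C D where
  bijective : Function.Bijective toBimodHom.left
  counit_comp : ∀ c : C,
    (Coring.counit : BimodHom A A D A).left (toBimodHom.left c) =
      (Coring.counit : BimodHom A A C A).left c
  comul_comp : ∀ c : C,
    (Coring.comul : BimodHom A A D (BTensor A D D)).left (toBimodHom.left c) =
      BTensor.map toBimodHom.right toBimodHom.left
        ((Coring.comul : BimodHom A A C (BTensor A C C)).left c)

section Comodule

variable (A : Type*) [Ring A] (C : Type*) [AddCommGroup C] [Module A C] [Module Aᵐᵒᵖ C]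
    [SMulCommClass A Aᵐᵒᵖ C] [Coring A C]

/-- A left `C`-comodule structure on a left `A`-module `N`: a left `A`-linear coaction
`N → C ⊗_A N` that is coassociative and counital. -/
class LeftComodule (N : Type*) [AddCommGroup N] [Module A N] where
  coact : N →ₗ[A] BTensor A C N
  coassoc : ∀ n : N,
    BTensor.assoc A A C C N
        (BTensor.map (Coring.comul : BimodHom A A C (BTensor A C C)).right LinearMap.id
          (coact n)) =
      BTensor.map LinearMap.id coact (coact n)
  counit : ∀ n : N,
    BTensor.lid A N
      (BTensor.map (Coring.counit : BimodHom A A C A).right LinearMap.id (coact n)) = n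

variable (N : Type*) [AddCommGroup N] [Module A N] [LeftComodule A C N]

/-- The coaction of a left `C`-comodule. -/
def coaction : N →ₗ[A] BTensor A C N := LeftComodule.coact

/-- The ring, under composition `(f * g) n = f (g n)`, of endomorphisms of a left `C`-comodule. -/
def comoduleEnd : Subring (Module.End A N) where
  carrier := {f | ∀ n, coaction A C N (f n) = BTensor.map LinearMap.id f (coaction A C N n)}
  one_mem' n := (BTensor.map_id _).symm
  zero_mem' n := by
    rw [BTensor.map_zero_right, LinearMap.zero_apply, map_zero]
  mul_mem' {f g} hf hg n := by
    rw [Module.End.mul_apply, hf, hg, BTensor.map_map]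
    rfl
  add_mem' {f g} hf hg n := by
    rw [LinearMap.add_apply, map_add, hf, hg, BTensor.map_add_right]
  neg_mem' {f} hf n := by
    have h := BTensor.map_add_right (LinearMap.id : C →ₗ[Aᵐᵒᵖ] C) f (-f) (coaction A C N n)
    rw [add_neg_cancel, BTensor.map_zero_right, ← hf n] at h
    rw [LinearMap.neg_apply, map_neg]
    exact neg_eq_of_add_eq_zero_right h.symm

/-- The ring `T = End^C(N)` of endomorphisms of a left `C`-comodule `N`, written on the right of
their arguments: the product `s * t` in `T` is "first `s`, then `t`", so that `N` is a right
`T`-module. -/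
abbrev EndC : Type _ := (comoduleEnd A C N)ᵐᵒᵖ

variable {A C N}

/-- `N` is a right module over any subring `B` of `End^C(N)`. -/
instance subringModule (B : Subring (EndC A C N)) : Module (↥B)ᵐᵒᵖ N where
  smul b n := ((unop b : B) : EndC A C N).unop.1 n
  one_smul n := rfl
  mul_smul b c n := rfl
  smul_zero b := map_zero _
  smul_add b := map_add _
  add_smul b c n := rfl
  zero_smul n := rfl

theorem subring_smul_def (B : Subring (EndC A C N)) (b : B) (n : N) :
    op b • n = (b : EndC A C N).unop.1 n := rfl

instance (B : Subring (EndC A C N)) : SMulCommClass A (↥B)ᵐᵒᵖ N where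
  smul_comm a b n := (map_smul ((unop b : B) : EndC A C N).unop.1 a n).symm

end Comodule

/-- An `(A, B)`-bimodule `N` with a left `C`-coaction that is right `B`-linear; in other words, a
`(C, B)`-bicomodule for the trivial `B`-coring `B`. -/
class IsBicomodule (A : Type*) [Ring A] (C : Type*) [AddCommGroup C] [Module A C]
    [Module Aᵐᵒᵖ C] [SMulCommClass A Aᵐᵒᵖ C] [Coring A C] (B : Type*) [Ring B]
    (N : Type*) [AddCommGroup N] [Module A N] [Module Bᵐᵒᵖ N] [SMulCommClass A Bᵐᵒᵖ N]
    [LeftComodule A C N] : Prop where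
  coaction_op_smul : ∀ (b : Bᵐᵒᵖ) (n : N), coaction A C N (b • n) = b • coaction A C N n

instance {A : Type*} [Ring A] {C : Type*} [AddCommGroup C] [Module A C] [Module Aᵐᵒᵖ C]
    [SMulCommClass A Aᵐᵒᵖ C] [Coring A C] {N : Type*} [AddCommGroup N] [Module A N]
    [LeftComodule A C N] (B : Subring (EndC A C N)) : IsBicomodule A C B N where
  coaction_op_smul b n := ((unop b : B) : EndC A C N).unop.2 n

section HomR

variable (A : Type*) [Ring A] (C : Type*) [AddCommGroup C] [Module A C] [Module Aᵐᵒᵖ C]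
    [SMulCommClass A Aᵐᵒᵖ C] (X : Type*) [AddCommGroup X] [Module Aᵐᵒᵖ X]

/-- `[C, X] = Hom_A(C, X)`, the right `A`-linear maps from an `(A, A)`-bimodule `C` to a right
`A`-module `X`; it is a right `A`-module by `(f · a) c = f (a c)`. -/
def HomR : Type _ := C →ₗ[Aᵐᵒᵖ] X

namespace HomR

instance : AddCommGroup (HomR A C X) := inferInstanceAs (AddCommGroup (C →ₗ[Aᵐᵒᵖ] X))

variable {A C X}

/-- The underlying linear map. -/
def lin (f : HomR A C X) : C →ₗ[Aᵐᵒᵖ] X := f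

@[ext]
theorem ext {f g : HomR A C X} (h : ∀ c, f.lin c = g.lin c) : f = g := LinearMap.ext h

theorem add_lin (f g : HomR A C X) : (f + g).lin = f.lin + g.lin := rfl

instance : Module Aᵐᵒᵖ (HomR A C X) where
  smul a f := f.lin ∘ₗ BTensor.leftMul A C (unop a)
  one_smul f := ext fun c => congrArg f.lin (one_smul A c)
  mul_smul a b f := ext fun c => congrArg f.lin (mul_smul (unop b) (unop a) c)
  smul_zero a := rfl
  smul_add a f g := rfl
  add_smul a b f := ext fun c =>
    (congrArg f.lin (add_smul (unop a) (unop b) c)).trans (map_add f.lin _ _)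
  zero_smul f := ext fun c => (congrArg f.lin (zero_smul A c)).trans (map_zero f.lin)

theorem smul_lin (a : Aᵐᵒᵖ) (f : HomR A C X) (c : C) : (a • f).lin c = f.lin (unop a • c) := rfl

/-- Postcomposition `[C, g]`. -/
def postcomp {Y : Type*} [AddCommGroup Y] [Module Aᵐᵒᵖ Y] (g : X →ₗ[Aᵐᵒᵖ] Y) :
    HomR A C X →ₗ[Aᵐᵒᵖ] HomR A C Y where
  toFun f := g ∘ₗ f.lin
  map_add' f f' := ext fun c => map_add g _ _
  map_smul' a f := rfl

theorem postcomp_lin {Y : Type*} [AddCommGroup Y] [Module Aᵐᵒᵖ Y] (g : X →ₗ[Aᵐᵒᵖ] Y)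
    (f : HomR A C X) (c : C) : (postcomp g f).lin c = g (f.lin c) := rfl

/-- `[C, [C, X]] ≅ Hom_A(C ⊗_A C, X)`, `h ↦ (c ⊗ c' ↦ h(c)(c'))`. -/
def uncurry (h : HomR A C (HomR A C X)) : BTensor A C C →+ X :=
  BTensor.lift (AddMonoidHom.mk' (fun c => (h.lin c).lin.toAddMonoidHom)
    (fun c d => by ext e; simp [map_add, add_lin])) (by
      intro c a d
      change (h.lin (op a • c)).lin d = (h.lin c).lin (a • d)
      rw [map_smul]
      rfl)

@[simp]
theorem uncurry_tmul (h : HomR A C (HomR A C X)) (c d : C) :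
    uncurry h (BTensor.tmul A c d) = (h.lin c).lin d := rfl

theorem uncurry_op_smul (h : HomR A C (HomR A C X)) (a : Aᵐᵒᵖ) (t : BTensor A C C) :
    uncurry h (a • t) = a • uncurry h t := by
  induction t using BTensor.induction_on with
  | zero => simp only [smul_zero, map_zero]
  | tmul c d => exact map_smul (h.lin c).lin a d
  | add x y hx hy => simp only [smul_add, map_add, hx, hy]

theorem uncurry_add (h h' : HomR A C (HomR A C X)) (t : BTensor A C C) :
    uncurry (h + h') t = uncurry h t + uncurry h' t := by
  induction t using BTensor.induction_on with
  | zero => simp only [add_zero, map_zero]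
  | tmul c d => rfl
  | add x y hx hy => simp only [map_add, hx, hy]; abel

theorem uncurry_smul (h : HomR A C (HomR A C X)) (a : A) (t : BTensor A C C) :
    uncurry (op a • h) t = uncurry h (a • t) := by
  induction t using BTensor.induction_on with
  | zero => simp only [smul_zero, map_zero]
  | tmul c d => rfl
  | add x y hx hy => simp only [smul_add, map_add, hx, hy]

variable [Coring A C]

variable (A C X) in
/-- The unit `X → [C, X]`, `x ↦ (c ↦ x ε(c))`, of the monad `[C, -]`. -/
def unit : X →ₗ[Aᵐᵒᵖ] HomR A C X where
  toFun x :=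
    { toFun := fun c => op ((Coring.counit : BimodHom A A C A).left c) • x
      map_add' := fun c d => by rw [map_add, MulOpposite.op_add, add_smul]
      map_smul' := fun a c => by
        have h := (Coring.counit : BimodHom A A C A).map_op_smul' a c
        change (Coring.counit : BimodHom A A C A).left (a • c) =
          (Coring.counit : BimodHom A A C A).left c * unop a at h
        rw [h, op_mul, op_unop, mul_smul]
        rfl }
  map_add' x y := ext fun c => smul_add _ x y
  map_smul' a x := ext fun c => by
    change op ((Coring.counit : BimodHom A A C A).left c) • a • x =
      op ((Coring.counit : BimodHom A A C A).left (unop a • c)) • x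
    rw [map_smul, smul_eq_mul, op_mul, op_unop, mul_smul]

variable (A C X) in
/-- The multiplication `[C, [C, X]] ≅ [C ⊗_A C, X] → [C, X]`, induced by `Δ`, of the monad
`[C, -]`. -/
def mult : HomR A C (HomR A C X) →ₗ[Aᵐᵒᵖ] HomR A C X where
  toFun h :=
    { toFun := fun c => uncurry h ((Coring.comul : BimodHom A A C (BTensor A C C)).left c)
      map_add' := fun c d => by rw [map_add, map_add]
      map_smul' := fun a c => by
        rw [← BimodHom.right_apply, map_smul, uncurry_op_smul]
        rfl }
  map_add' h h' := ext fun c => uncurry_add h h' _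
  map_smul' a h := ext fun c => by
    refine (uncurry_smul h (unop a) _).trans ?_
    exact congrArg (uncurry h)
      (map_smul (Coring.comul : BimodHom A A C (BTensor A C C)).left (unop a) c).symm

theorem unit_lin (x : X) (c : C) :
    (unit A C X x).lin c = op ((Coring.counit : BimodHom A A C A).left c) • x := rfl

theorem mult_lin (h : HomR A C (HomR A C X)) (c : C) :
    (mult A C X h).lin c =
      uncurry h ((Coring.comul : BimodHom A A C (BTensor A C C)).left c) := rfl

theorem mult_unit (f : HomR A C X) : mult A C X (unit A C (HomR A C X) f) = f := by
  ext c
  rw [mult_lin]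
  conv_rhs => rw [← Coring.counit_comul (A := A) c]
  generalize (Coring.comul : BimodHom A A C (BTensor A C C)).left c = t
  induction t using BTensor.induction_on with
  | zero => simp only [map_zero]
  | tmul c d => rfl
  | add x y hx hy => simp only [map_add, hx, hy]

theorem mult_postcomp_unit (f : HomR A C X) :
    mult A C X (postcomp (unit A C X) f) = f := by
  ext c
  rw [mult_lin]
  conv_rhs => rw [← Coring.comul_counit (A := A) c]
  generalize (Coring.comul : BimodHom A A C (BTensor A C C)).left c = t
  induction t using BTensor.induction_on with
  | zero => simp only [map_zero]
  | tmul c d => exact (map_smul f.lin _ c).symm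
  | add x y hx hy => simp only [map_add, hx, hy]

/-- `[C, [C, [C, X]]] → Hom(C ⊗_A (C ⊗_A C), X)`, used to check associativity. -/
def uncurry₃ (h : HomR A C (HomR A C (HomR A C X))) : BTensor A C (BTensor A C C) →+ X :=
  BTensor.lift (AddMonoidHom.mk' (fun c => uncurry (h.lin c))
    (fun c d => by ext e; simp [map_add, uncurry_add])) (by
      intro c a d
      change uncurry (h.lin (op a • c)) d = uncurry (h.lin c) (a • d)
      rw [map_smul, uncurry_smul])

theorem mult_assoc (h : HomR A C (HomR A C (HomR A C X))) :
    mult A C X (postcomp (mult A C X) h) = mult A C X (mult A C (HomR A C X) h) := by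
  ext c
  rw [mult_lin, mult_lin]
  have e1 : ∀ t : BTensor A C C, uncurry (postcomp (mult A C X) h) t =
      uncurry₃ h (BTensor.map LinearMap.id
        (Coring.comul : BimodHom A A C (BTensor A C C)).left t) := by
    intro t
    induction t using BTensor.induction_on with
    | zero => simp only [map_zero]
    | tmul c d => rfl
    | add x y hx hy => simp only [map_add, hx, hy]
  have e3 : ∀ (s : BTensor A C C) (d : C), (uncurry h s).lin d =
      uncurry₃ h (BTensor.assoc A A C C C (BTensor.tmul A s d)) := by
    intro s d
    induction s using BTensor.induction_on with
    | zero =>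
      have : BTensor.tmul A (0 : BTensor A C C) d = 0 :=
        map_zero ((BTensor.mk A (BTensor A C C) C).flip d)
      rw [this, map_zero, map_zero, map_zero]
      rfl
    | tmul c d => rfl
    | add x y hx hy => rw [BTensor.add_tmul, map_add, map_add, map_add, add_lin,
        LinearMap.add_apply, hx, hy]
  have e2 : ∀ t : BTensor A C C, uncurry (mult A C (HomR A C X) h) t =
      uncurry₃ h (BTensor.assoc A A C C C (BTensor.map
        (Coring.comul : BimodHom A A C (BTensor A C C)).right LinearMap.id t)) := by
    intro t
    induction t using BTensor.induction_on with
    | zero => simp only [map_zero]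
    | tmul c d => exact e3 _ d
    | add x y hx hy => simp only [map_add, hx, hy]
  rw [e1, e2, Coring.coassoc]

end HomR

end HomR

section Contramodules

variable (A : Type u) [Ring A] (C : Type u) [AddCommGroup C] [Module A C] [Module Aᵐᵒᵖ C]
    [SMulCommClass A Aᵐᵒᵖ C] [Coring A C]

/-- The monad `[C, -] = Hom_A(C, -)` on the category `M_A` of right `A`-modules. -/
def contraMonad : Monad (ModuleCat.{u} Aᵐᵒᵖ) where
  obj X := ModuleCat.of Aᵐᵒᵖ (HomR A C X)
  map g := ModuleCat.ofHom (HomR.postcomp g.hom)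
  map_id X := rfl
  map_comp f g := rfl
  η := { app := fun X => ModuleCat.ofHom (HomR.unit A C X)
         naturality := fun X Y g => by
          refine ModuleCat.hom_ext (LinearMap.ext fun x => HomR.ext fun c => ?_)
          exact (map_smul g.hom (op ((Coring.counit : BimodHom A A C A).left c)) x).symm }
  μ := { app := fun X => ModuleCat.ofHom (HomR.mult A C X)
         naturality := fun X Y g => by
          refine ModuleCat.hom_ext (LinearMap.ext fun h => HomR.ext fun c => ?_)
          change HomR.uncurry (HomR.postcomp (HomR.postcomp g.hom) h) _ =
            g.hom (HomR.uncurry h _)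
          generalize (Coring.comul : BimodHom A A C (BTensor A C C)).left c = t
          induction t using BTensor.induction_on with
          | zero => simp only [map_zero]
          | tmul c d => rfl
          | add x y hx hy => simp only [map_add, hx, hy] }
  assoc X := by
    exact ModuleCat.hom_ext (LinearMap.ext fun h => HomR.mult_assoc h)
  left_unit X := by
    exact ModuleCat.hom_ext (LinearMap.ext fun f => HomR.mult_unit f)
  right_unit X := by
    exact ModuleCat.hom_ext (LinearMap.ext fun f => HomR.mult_postcomp_unit f)

/-- The category `M_{[C,-]}` of (right) `C`-contramodules, i.e. of modules over the monad
`[C, -]`. -/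
abbrev Contramodule := (contraMonad A C).Algebra

variable {A C}

/-- The structure map `[C, M] → M` of a contramodule. -/
def Contramodule.act (M : Contramodule A C) : HomR A C M.A →ₗ[Aᵐᵒᵖ] M.A := M.a.hom

variable (A C) (B : Type u) [Ring B] (N : Type u) [AddCommGroup N] [Module A N]
    [Module Bᵐᵒᵖ N] [SMulCommClass A Bᵐᵒᵖ N] [LeftComodule A C N]

/-- For `f ∈ Hom_A(C, X)`, the map `(f ⊗_A N) ∘ ρ : N → X ⊗_A N`, where `ρ` is the coaction. -/
def canFun {X : Type u} [AddCommGroup X] [Module Aᵐᵒᵖ X] (f : HomR A C X) :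
    N →+ BTensor A X N :=
  (BTensor.map f.lin LinearMap.id).comp (coaction A C N).toAddMonoidHom

/-- The component at `X` of the canonical monad morphism
`can : Hom_A(C, -) → Hom_B(N, - ⊗_A N)`, `f ↦ (f ⊗_A N) ∘ ρ`. -/
def can [IsBicomodule A C B N] (X : Type u) [AddCommGroup X] [Module Aᵐᵒᵖ X] :
    HomR A C X →+ (N →ₗ[Bᵐᵒᵖ] BTensor A X N) :=
  AddMonoidHom.mk'
    (fun f => (BTensor.mapRight B N f.lin) ∘ₗ
      { toFun := coaction A C N
        map_add' := map_add _
        map_smul' := IsBicomodule.coaction_op_smul })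
    (fun f g => by
      ext n
      exact BTensor.map_add_left f.lin g.lin LinearMap.id (coaction A C N n))

/-- `N` is a `[C, -]`-Galois bicomodule (with respect to `B`): the canonical monad morphism
`Hom_A(C, -) → Hom_B(N, - ⊗_A N)` of endofunctors of `M_A` is an isomorphism, that is, all its
(right `A`-linear) components are bijective. -/
def IsContraGalois [IsBicomodule A C B N] : Prop :=
  ∀ X : ModuleCat.{u} Aᵐᵒᵖ, Function.Bijective (can A C B N X)

variable {A C} in
/-- The `B`-submodule of `M ⊗_A N` generated by the elements
`(f ⊗_A N)(ρ(n)) - α(f) ⊗ n` for `f ∈ Hom_A(C, M)`, `n ∈ N`, where `α` is the contraaction of `M`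
and `ρ` is the coaction of `N`. -/
def contraRel (M : Contramodule A C) : Submodule Bᵐᵒᵖ (BTensor A M.A N) :=
  Submodule.span Bᵐᵒᵖ {t | ∃ (f : HomR A C M.A) (n : N),
    t = canFun A C N f n - BTensor.tmul A (M.act f) n}

variable {A C} in
/-- The contratensor product `M ⊗_{[C,-]} N`: the coequaliser of the two maps
`Hom_A(C, M) ⊗_A N → M ⊗_A N`, `f ⊗ n ↦ (f ⊗_A N)(ρ(n))` and `f ⊗ n ↦ α(f) ⊗ n`. -/
abbrev ContraTensor (M : Contramodule A C) : Type u := BTensor A M.A N ⧸ contraRel B N M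

variable {A C} in
theorem contraRel_le {M M' : Contramodule A C} (g : M ⟶ M') :
    contraRel B N M ≤ (contraRel B N M').comap (BTensor.mapRight B N g.f.hom) := by
  rw [contraRel, Submodule.span_le]
  rintro _ ⟨f, n, rfl⟩
  refine Submodule.subset_span ⟨HomR.postcomp g.f.hom f, n, ?_⟩
  have h1 : M'.act (HomR.postcomp g.f.hom f) = g.f.hom (M.act f) :=
    congrArg (fun k => k.hom f) g.h
  rw [h1, map_sub]
  congr 1
  exact BTensor.map_map _ _ _ _ _

variable {A C} in
/-- The map `g ⊗_{[C,-]} N` induced by a morphism `g` of contramodules. -/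
def contraTensorMap {M M' : Contramodule A C} (g : M ⟶ M') :
    ContraTensor B N M →ₗ[Bᵐᵒᵖ] ContraTensor B N M' :=
  Submodule.mapQ _ _ (BTensor.mapRight B N g.f.hom) (contraRel_le B N g)

variable {A C} in
theorem contraTensorMap_mk {M M' : Contramodule A C} (g : M ⟶ M') (t : BTensor A M.A N) :
    contraTensorMap B N g (Submodule.Quotient.mk t) =
      Submodule.Quotient.mk (BTensor.mapRight B N g.f.hom t) := rfl

variable {A C} in
theorem contraTensorMap_id (M : Contramodule A C) :
    contraTensorMap B N (𝟙 M) = LinearMap.id := by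
  refine LinearMap.ext fun t => ?_
  obtain ⟨t, rfl⟩ := Submodule.Quotient.mk_surjective _ t
  rw [contraTensorMap_mk]
  exact congrArg (Submodule.Quotient.mk (p := contraRel B N M)) (BTensor.map_id t)

variable {A C} in
theorem contraTensorMap_comp {M M' M'' : Contramodule A C} (g : M ⟶ M') (g' : M' ⟶ M'') :
    contraTensorMap B N (g ≫ g') = contraTensorMap B N g' ∘ₗ contraTensorMap B N g := by
  refine LinearMap.ext fun t => ?_
  obtain ⟨t, rfl⟩ := Submodule.Quotient.mk_surjective _ t
  rw [LinearMap.comp_apply, contraTensorMap_mk, contraTensorMap_mk, contraTensorMap_mk]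
  exact congrArg (Submodule.Quotient.mk (p := contraRel B N M''))
    (BTensor.map_map g'.f.hom LinearMap.id g.f.hom LinearMap.id t).symm

/-- The functor `- ⊗_{[C,-]} N : M_{[C,-]} → M_B`. -/
def contraTensorFunctor : Contramodule A C ⥤ ModuleCat.{u} Bᵐᵒᵖ where
  obj M := ModuleCat.of Bᵐᵒᵖ (ContraTensor B N M)
  map g := ModuleCat.ofHom (contraTensorMap B N g)
  map_id M := ModuleCat.hom_ext (contraTensorMap_id B N M)
  map_comp g g' := ModuleCat.hom_ext (contraTensorMap_comp B N g g')

end Contramodules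

/-- A left module `N` over a (not necessarily commutative) ring `A` is faithfully flat if a
sequence `X → Y → Z` of right `A`-modules is exact precisely when
`X ⊗_A N → Y ⊗_A N → Z ⊗_A N` is. -/
def IsFaithfullyFlat (A : Type u) [Ring A] (N : Type u) [AddCommGroup N] [Module A N] : Prop :=
  ∀ (X Y Z : ModuleCat.{u} Aᵐᵒᵖ) (f : X →ₗ[Aᵐᵒᵖ] Y) (g : Y →ₗ[Aᵐᵒᵖ] Z),
    Function.Exact f g ↔
      Function.Exact (BTensor.map f (LinearMap.id : N →ₗ[A] N))
        (BTensor.map g (LinearMap.id : N →ₗ[A] N))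

section LeftDual

variable (A : Type*) [Ring A] (N : Type*) [AddCommGroup N] [Module A N]

/-- The left dual `*N = Hom_{A,-}(N, A)` of a left `A`-module; it is a right `A`-module by
`(f · a) n = f(n) a`, and a left `B`-module by `(b · f) n = f(n b)` if `N` is an
`(A, B)`-bimodule. -/
def LeftDual : Type _ := N →ₗ[A] A

namespace LeftDual

instance : AddCommGroup (LeftDual A N) := inferInstanceAs (AddCommGroup (N →ₗ[A] A))

instance : Module Aᵐᵒᵖ (LeftDual A N) := inferInstanceAs (Module Aᵐᵒᵖ (N →ₗ[A] A))

variable {A N}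

/-- The underlying linear map. -/
def lin (f : LeftDual A N) : N →ₗ[A] A := f

@[ext]
theorem ext {f g : LeftDual A N} (h : ∀ n, f.lin n = g.lin n) : f = g := LinearMap.ext h

theorem add_lin (f g : LeftDual A N) (n : N) : (f + g).lin n = f.lin n + g.lin n := rfl

theorem sum_lin {ι : Type*} (s : Finset ι) (f : ι → LeftDual A N) (n : N) :
    (∑ i ∈ s, f i).lin n = ∑ i ∈ s, (f i).lin n :=
  map_sum (AddMonoidHom.mk' (fun g : LeftDual A N => g.lin n) (fun _ _ => rfl)) f s

theorem op_smul_lin (a : Aᵐᵒᵖ) (f : LeftDual A N) (n : N) :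
    (a • f).lin n = f.lin n * unop a := rfl

variable {B : Type*} [Ring B] [Module Bᵐᵒᵖ N] [SMulCommClass A Bᵐᵒᵖ N]

instance : Module B (LeftDual A N) where
  smul b f := f.lin ∘ₗ BTensor.rightMul A N (op b)
  one_smul f := ext fun n => congrArg f.lin (one_smul Bᵐᵒᵖ n)
  mul_smul a b f := ext fun n => congrArg f.lin (mul_smul (op b) (op a) n)
  smul_zero b := rfl
  smul_add b f g := rfl
  add_smul a b f := ext fun n =>
    (congrArg f.lin (add_smul (op a) (op b) n)).trans (map_add f.lin _ _)
  zero_smul f := ext fun n => (congrArg f.lin (zero_smul Bᵐᵒᵖ n)).trans (map_zero f.lin)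

theorem smul_lin (b : B) (f : LeftDual A N) (n : N) : (b • f).lin n = f.lin (op b • n) := rfl

instance : SMulCommClass B Aᵐᵒᵖ (LeftDual A N) where
  smul_comm b a f := rfl

end LeftDual

/-- A finite dual basis of a left `A`-module. -/
structure DualBasis where
  card : ℕ
  vec : Fin card → N
  covec : Fin card → LeftDual A N
  sum_eq : ∀ n : N, ∑ i, (covec i).lin n • vec i = n

theorem exists_dualBasis [Module.Finite A N] [Module.Projective A N] :
    Nonempty (DualBasis A N) := by
  obtain ⟨k, f, g, -, -, hfg⟩ := Module.Finite.exists_comp_eq_id_of_projective A N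
  refine ⟨⟨k, fun i => f (Pi.single i 1), fun i => (LinearMap.proj i ∘ₗ g : N →ₗ[A] A), ?_⟩⟩
  intro n
  conv_rhs => rw [← LinearMap.id_apply (R := A) n, ← hfg, LinearMap.comp_apply,
    pi_eq_sum_univ' (g n), map_sum]
  refine Finset.sum_congr rfl fun i _ => ?_
  rw [map_smul]
  congr 2

variable {A N}
variable (B : Type*) [Ring B] [Module Bᵐᵒᵖ N] [SMulCommClass A Bᵐᵒᵖ N]

theorem DualBasis.smul_comm_tmul (e : DualBasis A N) (b : B) :
    ∑ i, BTensor.tmul A (e.covec i) (op b • e.vec i) =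
      ∑ i, BTensor.tmul A (b • e.covec i) (e.vec i) := by
  have h1 : ∀ i, BTensor.tmul A (e.covec i) (op b • e.vec i) =
      ∑ j, BTensor.tmul A (op ((e.covec j).lin (op b • e.vec i)) • e.covec i) (e.vec j) := by
    intro i
    conv_lhs => rw [← e.sum_eq (op b • e.vec i), BTensor.tmul_sum]
    exact Finset.sum_congr rfl fun j _ => (BTensor.balanced _ _ _).symm
  simp_rw [h1]
  rw [Finset.sum_comm]
  refine Finset.sum_congr rfl fun j _ => ?_
  rw [← BTensor.sum_tmul]
  congr 1
  ext n
  rw [LeftDual.sum_lin, LeftDual.smul_lin]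
  conv_rhs => rw [← e.sum_eq n, Finset.smul_sum, map_sum]
  refine Finset.sum_congr rfl fun i _ => ?_
  rw [LeftDual.op_smul_lin, unop_op]
  change _ = (e.covec j).lin (op b • (e.covec i).lin n • e.vec i)
  rw [← smul_comm, map_smul (e.covec j).lin ((e.covec i).lin n), smul_eq_mul]

/-- For `n ∈ N`, `f ∈ *N`, the additive map
`*N ⊗_A N → (N ⊗_B *N) ⊗_A (N ⊗_B *N)`, `g ⊗ m ↦ (n ⊗ g) ⊗ (m ⊗ f)`. -/
def sandwich (n : N) (f : LeftDual A N) : BTensor A (LeftDual A N) N →+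
    BTensor A (BTensor B N (LeftDual A N)) (BTensor B N (LeftDual A N)) :=
  BTensor.map
    { toFun := fun g => BTensor.tmul B n g
      map_add' := BTensor.tmul_add n
      map_smul' := fun a g => rfl }
    { toFun := fun m => BTensor.tmul B m f
      map_add' := fun m m' => BTensor.add_tmul m m' f
      map_smul' := fun a m => rfl }

/-- The comultiplication `n ⊗ f ↦ ∑ᵢ (n ⊗ eᵢ*) ⊗ (eᵢ ⊗ f)` on `N ⊗_B *N`, for a dual basis
`(eᵢ, eᵢ*)` of `N`, as an additive map. -/
def comatrixComul (e : DualBasis A N) : BTensor B N (LeftDual A N) →+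
    BTensor A (BTensor B N (LeftDual A N)) (BTensor B N (LeftDual A N)) :=
  BTensor.lift (AddMonoidHom.mk' (fun n => AddMonoidHom.mk'
      (fun f => ∑ i, BTensor.tmul A (BTensor.tmul B n (e.covec i)) (BTensor.tmul B (e.vec i) f))
      (fun f f' => by simp only [BTensor.tmul_add, Finset.sum_add_distrib]))
    (fun n n' => by
      ext f
      simp [BTensor.add_tmul, Finset.sum_add_distrib])) (by
    intro n b f
    have h := congrArg (sandwich B n f) (e.smul_comm_tmul B b)
    rw [map_sum, map_sum] at h
    change ∑ i, BTensor.tmul A (BTensor.tmul B n (e.covec i))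
        (BTensor.tmul B (op b • e.vec i) f) =
      ∑ i, BTensor.tmul A (BTensor.tmul B n (b • e.covec i)) (BTensor.tmul B (e.vec i) f) at h
    simp only [BTensor.balanced] at h
    simp only [AddMonoidHom.mk'_apply, BTensor.balanced]
    exact h.symm)

theorem comatrixComul_tmul (e : DualBasis A N) (n : N) (f : LeftDual A N) :
    comatrixComul B e (BTensor.tmul B n f) =
      ∑ i, BTensor.tmul A (BTensor.tmul B n (e.covec i)) (BTensor.tmul B (e.vec i) f) := rfl

/-- The counit `N ⊗_B *N → A`, `n ⊗ f ↦ f(n)`, as an additive map. -/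
def comatrixCounit : BTensor B N (LeftDual A N) →+ A :=
  BTensor.lift (AddMonoidHom.flip (AddMonoidHom.mk' (fun f => f.lin.toAddMonoidHom)
    (fun f g => rfl))) (by intro n b f; rfl)

theorem comatrixCounit_tmul (n : N) (f : LeftDual A N) :
    comatrixCounit B (BTensor.tmul B n f) = f.lin n := rfl

/-- The comatrix `A`-coring structure on `N ⊗_B *N` defined by a dual basis `(eᵢ, eᵢ*)` of `N`:
`Δ(n ⊗ f) = ∑ᵢ (n ⊗ eᵢ*) ⊗ (eᵢ ⊗ f)` and `ε(n ⊗ f) = f(n)`. -/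
@[reducible]
def DualBasis.coring (e : DualBasis A N) : Coring A (BTensor B N (LeftDual A N)) where
  comul :=
    { toFun := comatrixComul B e
      map_add' := map_add _
      map_smul' := fun a t => by
        induction t using BTensor.induction_on with
        | zero => simp only [smul_zero, map_zero]
        | tmul n f =>
          rw [BTensor.smul_tmul, comatrixComul_tmul, comatrixComul_tmul, RingHom.id_apply,
            Finset.smul_sum]
          rfl
        | add x y hx hy => simp only [smul_add, map_add, hx, hy]
      map_op_smul' := fun a t => by
        change comatrixComul B e (a • t) = a • comatrixComul B e t
        induction t using BTensor.induction_on with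
        | zero => simp only [smul_zero, map_zero]
        | tmul n f =>
          rw [BTensor.op_smul_tmul, comatrixComul_tmul, comatrixComul_tmul, Finset.smul_sum]
          rfl
        | add x y hx hy => simp only [smul_add, map_add, hx, hy] }
  counit :=
    { toFun := comatrixCounit B
      map_add' := map_add _
      map_smul' := fun a t => by
        induction t using BTensor.induction_on with
        | zero => simp only [smul_zero, map_zero]
        | tmul n f => exact map_smul f.lin a n
        | add x y hx hy => simp only [smul_add, map_add, hx, hy]
      map_op_smul' := fun a t => by
        change comatrixCounit B (a • t) = a • comatrixCounit B t
        induction t using BTensor.induction_on with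
        | zero => simp only [smul_zero, map_zero]
        | tmul n f => rfl
        | add x y hx hy => simp only [smul_add, map_add, hx, hy] }
  coassoc t := by
    induction t using BTensor.induction_on with
    | zero => simp only [map_zero]
    | tmul n f =>
      change BTensor.assoc A A _ _ _ (BTensor.map _ _ (comatrixComul B e (BTensor.tmul B n f))) =
        BTensor.map _ _ (comatrixComul B e (BTensor.tmul B n f))
      rw [comatrixComul_tmul]
      simp only [map_sum, BTensor.map_tmul, LinearMap.id_apply, BimodHom.right_apply]
      change ∑ i, BTensor.assoc A A _ _ _
          (BTensor.tmul A (comatrixComul B e (BTensor.tmul B n (e.covec i))) _) =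
        ∑ i, BTensor.tmul A _ (comatrixComul B e (BTensor.tmul B (e.vec i) f))
      simp only [comatrixComul_tmul, BTensor.sum_tmul, BTensor.tmul_sum, map_sum,
        BTensor.assoc_tmul]
      exact Finset.sum_comm
    | add x y hx hy => simp only [map_add, hx, hy]
  counit_comul t := by
    induction t using BTensor.induction_on with
    | zero => simp only [map_zero]
    | tmul n f =>
      change BTensor.lid A _ (BTensor.map _ _ (comatrixComul B e (BTensor.tmul B n f))) = _
      rw [comatrixComul_tmul]
      simp only [map_sum, BTensor.map_tmul, LinearMap.id_apply, BTensor.lid_tmul]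
      change ∑ i, BTensor.tmul B ((e.covec i).lin n • e.vec i) f = _
      rw [← BTensor.sum_tmul, e.sum_eq]
    | add x y hx hy => simp only [map_add, hx, hy]
  comul_counit t := by
    induction t using BTensor.induction_on with
    | zero => simp only [map_zero]
    | tmul n f =>
      change BTensor.rid A _ (BTensor.map _ _ (comatrixComul B e (BTensor.tmul B n f))) = _
      rw [comatrixComul_tmul]
      simp only [map_sum, BTensor.map_tmul, LinearMap.id_apply, BTensor.rid_tmul]
      change ∑ i, BTensor.tmul B n (op (f.lin (e.vec i)) • e.covec i) = _
      rw [← BTensor.tmul_sum]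
      congr 1
      ext m
      rw [LeftDual.sum_lin]
      conv_rhs => rw [← e.sum_eq m, map_sum]
      refine Finset.sum_congr rfl fun i _ => ?_
      rw [LeftDual.op_smul_lin, unop_op, map_smul, smul_eq_mul]
    | add x y hx hy => simp only [map_add, hx, hy]

/-- The comatrix `A`-coring `N ⊗_B *N` of an `(A, B)`-bimodule `N` that is finitely generated and
projective as a left `A`-module. The comultiplication is written with a chosen dual basis; it does
not depend on the choice, since `∑ᵢ eᵢ* ⊗ eᵢ ∈ *N ⊗_A N` does not. -/
noncomputable instance comatrixCoring [Module.Finite A N] [Module.Projective A N] :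
    Coring A (BTensor B N (LeftDual A N)) :=
  (Classical.choice (exists_dualBasis A N)).coring B

end LeftDual

end ContraGalois

open ContraGalois

/-! The Galois condition identifies the monad [C, -] with the monad Hom_B(N, - ⊗_A N) of the
adjunction between - ⊗_A N and Hom_B(N, -); `can_unit` and `canTensor_can` say that units and
multiplications correspond. For a projective generator N the functor Hom_B(N, -) is exact and
faithful, hence monadic: V ↦ Hom_B(N, V) is an equivalence from right B-modules to contramodules,
with inverse the contratensor product.

The proof makes this explicit. Projectivity enters by lifting a map out of N and reading the lift as
`can` of some f, in `exists_lift` and `contraUnit_bijective`. The generator property enters by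
testing inclusions of submodules, or the ideal of B containing 1, on maps out of N.
`contraUnit_bijective` (the unit of the adjunction) gives full faithfulness, and
`HomB.contraTensorEquiv` (the counit) gives essential surjectivity.

The other conclusions use the same isomorphism Hom_A(C, -) ≅ Hom_B(N, - ⊗_A N). Its right side
preserves epimorphisms, so C is projective. Every B-linear map N → End_A(N) factors through *N ⊗_A N
(`dualEval_surjective`), so the identity of N comes from a dual basis. With a dual basis, Hom_B(N, X
⊗_A N) ≅ Hom_A(N ⊗_B *N, X), and a Yoneda argument makes `comatrixMap` bijective. Taking X = A,
every B-endomorphism of N arises from a functional on C, hence commutes with comodule endomorphisms;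
since N generates, this forces T = B. If C is a generator, exactness can be tested on Hom_A(C, -),
and so after - ⊗_A N. -/

namespace ContraGalois

/-! ### Generators of module categories -/

section Separator

/-- Every module is generated by the images of the maps from a generator. -/
theorem iSup_range_eq_top_of_isSeparator {R : Type u} [Ring R] {P : Type u} [AddCommGroup P]
    [Module R P] (hP : IsSeparator (ModuleCat.of R P)) (M : Type u) [AddCommGroup M]
    [Module R M] : ⨆ h : P →ₗ[R] M, LinearMap.range h = ⊤ := by
  -- The quotient map by the sum of all images and the zero map agree on every map from P, so the
  -- separator property makes the quotient map zero.
  have key := hP.def (ModuleCat.ofHom (⨆ h : P →ₗ[R] M, LinearMap.range h).mkQ)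
    (ModuleCat.ofHom 0) (fun h => ModuleCat.hom_ext (LinearMap.ext fun x => by
      change Submodule.mkQ _ (h.hom x) = 0
      rw [Submodule.mkQ_apply, Submodule.Quotient.mk_eq_zero]
      exact Submodule.mem_iSup_of_mem h.hom ⟨x, rfl⟩))
  have key' := congrArg ModuleCat.Hom.hom key
  rw [ModuleCat.hom_ofHom, ModuleCat.hom_ofHom, ← LinearMap.ker_eq_top, Submodule.ker_mkQ] at key'
  exact key'

/-- K is itself generated by the images of maps P → K, so an inclusion need only be tested on these.
With K = ⊤ this is a test for surjectivity or for vanishing. -/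
theorem le_of_isSeparator {R : Type u} [Ring R] {P : Type u} [AddCommGroup P]
    [Module R P] (hP : IsSeparator (ModuleCat.of R P)) {M : Type u} [AddCommGroup M]
    [Module R M] (K L : Submodule R M)
    (h : ∀ g : P →ₗ[R] M, (∀ p, g p ∈ K) → ∀ p, g p ∈ L) : K ≤ L := by
  intro x hx
  have hx' : (⟨x, hx⟩ : K) ∈ L.comap K.subtype := by
    have htop : (⨆ g : P →ₗ[R] K, LinearMap.range g) ≤ L.comap K.subtype := by
      refine iSup_le fun g => ?_
      rintro _ ⟨p, rfl⟩
      exact h (K.subtype ∘ₗ g) (fun p => (g p).2) p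
    rw [iSup_range_eq_top_of_isSeparator hP K] at htop
    exact htop trivial
  exact hx'

end Separator

/-! ### Contraction of tensors with linear forms -/

namespace BTensor

variable {A : Type*} [Ring A] {M M' : Type*} [AddCommGroup M] [Module Aᵐᵒᵖ M]
  [AddCommGroup M'] [Module Aᵐᵒᵖ M'] {N N' : Type*} [AddCommGroup N] [Module A N]
  [AddCommGroup N'] [Module A N']

theorem tmul_zero (m : M) : tmul A m (0 : N) = 0 := map_zero (mk A M N m)

theorem zero_tmul (n : N) : tmul A (0 : M) n = 0 := map_zero ((mk A M N).flip n)

theorem exists_sum_tmul (t : BTensor A M N) :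
    ∃ (k : ℕ) (m : Fin k → M) (n : Fin k → N), t = ∑ i, tmul A (m i) (n i) := by
  induction t using induction_on with
  | zero => exact ⟨0, Fin.elim0, Fin.elim0, rfl⟩
  | tmul m n => exact ⟨1, fun _ => m, fun _ => n, by simp⟩
  | add x y hx hy =>
    obtain ⟨k, m, n, rfl⟩ := hx
    obtain ⟨k', m', n', rfl⟩ := hy
    exact ⟨k + k', Fin.append m m', Fin.append n n', by simp [Fin.sum_univ_add]⟩

theorem map_surjective {f : M →ₗ[Aᵐᵒᵖ] M'} (hf : Function.Surjective f) {g : N →ₗ[A] N'}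
    (hg : Function.Surjective g) : Function.Surjective (map f g) := by
  intro t
  induction t using induction_on with
  | zero => exact ⟨0, map_zero _⟩
  | tmul m n =>
    obtain ⟨m, rfl⟩ := hf m
    obtain ⟨n, rfl⟩ := hg n
    exact ⟨tmul A m n, rfl⟩
  | add x y hx hy =>
    obtain ⟨x, rfl⟩ := hx
    obtain ⟨y, rfl⟩ := hy
    exact ⟨x + y, map_add _ _ _⟩

theorem lid_map (g : N →ₗ[A] N') (t : BTensor A A N) :
    lid A N' (map LinearMap.id g t) = g (lid A N t) := by
  induction t using induction_on with
  | zero => simp only [map_zero]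
  | tmul m a => simp only [map_tmul, lid_tmul, LinearMap.id_apply, map_smul]
  | add x y hx hy => simp only [map_add, hx, hy]

/-- `M ⊗_A φ : M ⊗_A N → M ⊗_A A = M`, for a linear form `φ` on `N`. -/
def contract (φ : LeftDual A N) : BTensor A M N →+ M :=
  (rid A M).comp (map LinearMap.id φ.lin)

@[simp]
theorem contract_tmul (φ : LeftDual A N) (m : M) (n : N) :
    contract φ (tmul A m n) = op (φ.lin n) • m := rfl

theorem contract_map (φ : LeftDual A N) (f : M →ₗ[Aᵐᵒᵖ] M') (t : BTensor A M N) :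
    contract φ (map f LinearMap.id t) = f (contract φ t) := by
  induction t using induction_on with
  | zero => simp only [map_zero]
  | tmul m a => simp only [map_tmul, contract_tmul, LinearMap.id_apply, map_smul]
  | add x y hx hy => simp only [map_add, hx, hy]

theorem contract_add (φ ψ : LeftDual A N) (t : BTensor A M N) :
    contract (φ + ψ) t = contract φ t + contract ψ t := by
  induction t using induction_on with
  | zero => simp only [map_zero, add_zero]
  | tmul m n =>
    simp only [contract_tmul, LeftDual.add_lin]
    rw [MulOpposite.op_add, add_smul]
  | add x y hx hy => simp only [map_add, hx, hy]; abel

theorem contract_op_smul (a : Aᵐᵒᵖ) (φ : LeftDual A N) (t : BTensor A M N) :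
    contract (a • φ) t = a • contract φ t := by
  induction t using induction_on with
  | zero => simp only [map_zero, smul_zero]
  | tmul m n =>
    rw [contract_tmul, contract_tmul, LeftDual.op_smul_lin, op_mul, mul_smul, op_unop]
  | add x y hx hy => simp only [map_add, smul_add, hx, hy]

theorem contract_smul_left {S : Type*} [Ring S] [Module Sᵐᵒᵖ N] [SMulCommClass A Sᵐᵒᵖ N]
    (s : S) (φ : LeftDual A N) (t : BTensor A M N) :
    contract (s • φ) t = contract φ (op s • t) := by
  induction t using induction_on with
  | zero => simp only [map_zero, smul_zero]
  | tmul m n => rfl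
  | add x y hx hy => simp only [map_add, smul_add, hx, hy]

theorem contract_smul {R : Type*} [Ring R] [Module R M] [SMulCommClass R Aᵐᵒᵖ M]
    (r : R) (φ : LeftDual A N) (t : BTensor A M N) :
    contract φ (r • t) = r • contract φ t :=
  contract_map φ (leftMul A M r) t

/-- `contract φ` as a left linear map, for a bimodule `M`. -/
def contractLeft (R : Type*) [Ring R] [Module R M] [SMulCommClass R Aᵐᵒᵖ M]
    (φ : LeftDual A N) : BTensor A M N →ₗ[R] M where
  toFun := contract φ
  map_add' := map_add _
  map_smul' r t := contract_smul r φ t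

/-- The covectors act as coordinates: a tensor is recovered from its contractions, so equations in M
⊗_A N can be checked, and elements lifted, coordinate by coordinate in M. -/
theorem sum_tmul_contract (e : DualBasis A N) (t : BTensor A M N) :
    ∑ i, tmul A (contract (e.covec i) t) (e.vec i) = t := by
  induction t using induction_on with
  | zero => simp only [map_zero, zero_tmul, Finset.sum_const_zero]
  | tmul m n => simp only [contract_tmul, balanced, ← tmul_sum, e.sum_eq]
  | add x y hx hy => simp only [map_add, add_tmul, Finset.sum_add_distrib, hx, hy]

end BTensor

/-! ### Dual bases and the map *N ⊗_A N → End_A(N) -/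

section DualBasis

variable {A : Type*} [Ring A] {N : Type*} [AddCommGroup N] [Module A N]

theorem DualBasis.finite (e : DualBasis A N) : Module.Finite A N :=
  Module.Finite.of_surjective (Fintype.linearCombination A e.vec) fun n =>
    ⟨fun i => (e.covec i).lin n, e.sum_eq n⟩

theorem DualBasis.projective (e : DualBasis A N) : Module.Projective A N :=
  Module.Projective.of_split (LinearMap.pi fun i => (e.covec i).lin)
    (Fintype.linearCombination A e.vec) (LinearMap.ext e.sum_eq)

variable (A N) in
/-- The canonical map `*N ⊗_A N → End_A(N)`. -/
def dualEval (B : Type*) [Ring B] [Module Bᵐᵒᵖ N] [SMulCommClass A Bᵐᵒᵖ N] :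
    BTensor A (LeftDual A N) N →ₗ[Bᵐᵒᵖ] N →ₗ[A] N where
  toFun := BTensor.lift
    (AddMonoidHom.mk' (fun φ => AddMonoidHom.mk' (fun n => φ.lin.smulRight n)
      (fun n n' => by ext m; simp))
      (fun φ ψ => by ext n m; simp [LeftDual.add_lin, add_smul])) (by
        intro φ a n
        ext m
        simp [LeftDual.op_smul_lin, mul_smul])
  map_add' := map_add _
  map_smul' b t := by
    induction t using BTensor.induction_on with
    | zero => simp only [smul_zero, map_zero]
    | tmul φ n => ext m; exact smul_comm (φ.lin m) b n
    | add x y hx hy => simp only [smul_add, map_add, hx, hy]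

theorem dualEval_tmul (B : Type*) [Ring B] [Module Bᵐᵒᵖ N] [SMulCommClass A Bᵐᵒᵖ N]
    (φ : LeftDual A N) (n m : N) : dualEval A N B (BTensor.tmul A φ n) m = φ.lin m • n := rfl

/-- A preimage ∑ φᵢ ⊗ nᵢ of the identity of N is exactly a finite dual basis. -/
theorem nonempty_dualBasis_of_dualEval_surjective (B : Type*) [Ring B] [Module Bᵐᵒᵖ N]
    [SMulCommClass A Bᵐᵒᵖ N] (h : Function.Surjective (dualEval A N B)) :
    Nonempty (DualBasis A N) := by
  obtain ⟨t, ht⟩ := h LinearMap.id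
  obtain ⟨k, φ, n, rfl⟩ := BTensor.exists_sum_tmul t
  refine ⟨⟨k, n, φ, fun m => ?_⟩⟩
  have := congrArg (fun g => g m) ht
  simpa [LinearMap.sum_apply, dualEval_tmul] using this

end DualBasis

/-! ### The canonical map as a morphism of monads -/

section Can

variable {A : Type u} [Ring A] {C : Type u} [AddCommGroup C] [Module A C] [Module Aᵐᵒᵖ C]
  [SMulCommClass A Aᵐᵒᵖ C] [Coring A C] {B : Type u} [Ring B] {N : Type u} [AddCommGroup N]
  [Module A N] [Module Bᵐᵒᵖ N] [SMulCommClass A Bᵐᵒᵖ N] [LeftComodule A C N]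
  [IsBicomodule A C B N] {X Y : Type u} [AddCommGroup X] [Module Aᵐᵒᵖ X] [AddCommGroup Y]
  [Module Aᵐᵒᵖ Y]

theorem can_apply (f : HomR A C X) (n : N) :
    can A C B N X f n = BTensor.map f.lin LinearMap.id (coaction A C N n) := rfl

theorem can_postcomp (g : X →ₗ[Aᵐᵒᵖ] Y) (f : HomR A C X) (n : N) :
    can A C B N Y (HomR.postcomp g f) n = BTensor.map g LinearMap.id (can A C B N X f n) := by
  rw [can_apply, can_apply, BTensor.map_map]
  rfl

theorem can_op_smul (f : HomR A C X) (a : A) (n : N) :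
    can A C B N X (op a • f) n = can A C B N X f (a • n) := by
  rw [can_apply, can_apply, map_smul, BTensor.smul_eq, BTensor.map_map]
  rfl

/-- Compatibility with units is the counit axiom of the comodule N. -/
theorem can_unit (x : X) (n : N) :
    can A C B N X (HomR.unit A C X x) n = BTensor.tmul A x n := by
  conv_rhs => rw [← LeftComodule.counit (C := C) (A := A) n]
  change BTensor.map _ _ (LeftComodule.coact n) = _
  generalize (LeftComodule.coact n : BTensor A C N) = t
  induction t using BTensor.induction_on with
  | zero => simp only [map_zero, BTensor.tmul_zero]
  | tmul c m => exact BTensor.balanced x _ m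
  | add s t hs ht => simp only [map_add, hs, ht, BTensor.tmul_add]

/-- The map `[C, X] ⊗_A N → X ⊗_A N`, `f ⊗ n ↦ (f ⊗_A N)(ρ(n))`. -/
def canTensor (A : Type u) [Ring A] (C : Type u) [AddCommGroup C] [Module A C] [Module Aᵐᵒᵖ C]
    [SMulCommClass A Aᵐᵒᵖ C] [Coring A C] (B : Type u) [Ring B] (N : Type u) [AddCommGroup N]
    [Module A N] [Module Bᵐᵒᵖ N] [SMulCommClass A Bᵐᵒᵖ N] [LeftComodule A C N]
    [IsBicomodule A C B N] (X : Type u) [AddCommGroup X] [Module Aᵐᵒᵖ X] :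
    BTensor A (HomR A C X) N →ₗ[Bᵐᵒᵖ] BTensor A X N where
  toFun := BTensor.lift
    (AddMonoidHom.mk' (fun f => (can A C B N X f).toAddMonoidHom)
      (fun f g => by ext n; simp)) (fun f a n => can_op_smul f a n)
  map_add' := map_add _
  map_smul' b t := by
    induction t using BTensor.induction_on with
    | zero => simp only [smul_zero, map_zero]
    | tmul f n => exact map_smul (can A C B N X f) b n
    | add x y hx hy => simp only [smul_add, map_add, hx, hy]

/-- Compatibility with multiplications is coassociativity of the coaction ρ: one side applies h to
(C ⊗ ρ)ρ(n), the other to (Δ ⊗ N)ρ(n). -/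
theorem canTensor_can (h : HomR A C (HomR A C X)) (n : N) :
    canTensor A C B N X (can A C B N (HomR A C X) h n) =
      can A C B N X (HomR.mult A C X h) n := by
  -- The left side is written as a map on C ⊗_A (C ⊗_A N) evaluated at (C ⊗ ρ)(t), the form to which
  -- coassociativity applies.
  have h₁ : ∀ t : BTensor A C N, canTensor A C B N X (BTensor.map h.lin LinearMap.id t) =
      BTensor.lift (AddMonoidHom.mk' (fun c => BTensor.map (h.lin c).lin LinearMap.id)
        (fun c d => by
          refine AddMonoidHom.ext fun t => ?_
          rw [map_add, HomR.add_lin]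
          exact BTensor.map_add_left _ _ _ t))
        (fun c a s => by
          change BTensor.map (h.lin (op a • c)).lin LinearMap.id s =
            BTensor.map (h.lin c).lin LinearMap.id (a • s)
          rw [map_smul, BTensor.smul_eq, BTensor.map_map]
          rfl)
        (BTensor.map LinearMap.id (coaction A C N) t) := by
    intro t
    induction t using BTensor.induction_on with
    | zero => simp only [map_zero]
    | tmul c m => rfl
    | add s t hs ht => simp only [map_add, hs, ht]
  rw [can_apply, can_apply, h₁]
  have h₂ := LeftComodule.coassoc (A := A) (C := C) n
  change BTensor.assoc A A C C N (BTensor.map _ _ (coaction A C N n)) =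
    BTensor.map _ (coaction A C N) (coaction A C N n) at h₂
  rw [← h₂]
  generalize coaction A C N n = t
  induction t using BTensor.induction_on with
  | zero => simp only [map_zero]
  | tmul c m =>
    rw [BTensor.map_tmul, BTensor.map_tmul, HomR.mult_lin]
    change _ = BTensor.tmul A (HomR.uncurry h
      ((Coring.comul : BimodHom A A C (BTensor A C C)).left c)) m
    rw [BimodHom.right_apply]
    generalize (Coring.comul : BimodHom A A C (BTensor A C C)).left c = s
    induction s using BTensor.induction_on with
    | zero => rw [BTensor.zero_tmul]; simp only [map_zero]; rw [BTensor.zero_tmul]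
    | tmul c d => rfl
    | add x y hx hy => rw [BTensor.add_tmul, map_add, map_add, hx, hy, map_add, BTensor.add_tmul]
  | add s t hs ht => simp only [map_add, hs, ht]

end Can

/-! ### Consequences of the Galois condition: projectivity, finiteness, flatness -/

section Galois

variable {A : Type u} [Ring A] {C : Type u} [AddCommGroup C] [Module A C] [Module Aᵐᵒᵖ C]
  [SMulCommClass A Aᵐᵒᵖ C] [Coring A C] {B : Type u} [Ring B] {N : Type u} [AddCommGroup N]
  [Module A N] [Module Bᵐᵒᵖ N] [SMulCommClass A Bᵐᵒᵖ N] [LeftComodule A C N]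
  [IsBicomodule A C B N]

/-- A right `A`-linear map out of `C`, as an element of `[C, X]`. -/
def HomR.ofLin {X : Type u} [AddCommGroup X] [Module Aᵐᵒᵖ X] (f : C →ₗ[Aᵐᵒᵖ] X) : HomR A C X := f

namespace IsContraGalois

theorem hom_ext (hG : IsContraGalois A C B N) {X : Type u} [AddCommGroup X] [Module Aᵐᵒᵖ X]
    {f g : HomR A C X} (h : ∀ n, can A C B N X f n = can A C B N X g n) : f = g :=
  (hG (ModuleCat.of Aᵐᵒᵖ X)).1 (LinearMap.ext h)

theorem exists_can_eq (hG : IsContraGalois A C B N) {X : Type u} [AddCommGroup X]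
    [Module Aᵐᵒᵖ X] (h : N →ₗ[Bᵐᵒᵖ] BTensor A X N) :
    ∃ f : HomR A C X, ∀ n, can A C B N X f n = h n := by
  obtain ⟨f, hf⟩ := (hG (ModuleCat.of Aᵐᵒᵖ X)).2 h
  exact ⟨f, fun n => congrArg (fun k : N →ₗ[Bᵐᵒᵖ] BTensor A X N => k n) hf⟩

/-- A map `g` out of `C` lifts along `f` as soon as the corresponding map out of the projective
`B`-module `N` takes values in the image of `f ⊗_A N`. -/
theorem exists_lift (hG : IsContraGalois A C B N) [Module.Projective Bᵐᵒᵖ N] {X Y : Type u}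
    [AddCommGroup X] [Module Aᵐᵒᵖ X] [AddCommGroup Y] [Module Aᵐᵒᵖ Y] (f : X →ₗ[Aᵐᵒᵖ] Y)
    (g : HomR A C Y) (h : ∀ n, ∃ t, BTensor.map f LinearMap.id t = can A C B N Y g n) :
    ∃ k : HomR A C X, HomR.postcomp f k = g := by
  -- Since f ⊗_A N need not be surjective, the lifting is done against its corestriction to its
  -- range.
  obtain ⟨l, hl⟩ := Module.projective_lifting_property
    (LinearMap.rangeRestrict (BTensor.mapRight B N f))
    ((can A C B N Y g).codRestrict (LinearMap.range (BTensor.mapRight B N f)) h)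
    (LinearMap.surjective_rangeRestrict _)
  obtain ⟨k, hk⟩ := hG.exists_can_eq l
  refine ⟨k, hG.hom_ext fun n => ?_⟩
  rw [can_postcomp, hk]
  exact congrArg Subtype.val (LinearMap.congr_fun hl n)

/-- Tensoring with N preserves surjections, so the hypothesis of `exists_lift` holds for every g. -/
theorem projective (hG : IsContraGalois A C B N) [Module.Projective Bᵐᵒᵖ N] :
    Module.Projective Aᵐᵒᵖ C := by
  refine Module.Projective.of_lifting_property fun {X Y} _ _ _ _ f g hf => ?_
  exact hG.exists_lift f g fun n => BTensor.map_surjective hf Function.surjective_id _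

/-- As N generates, it suffices to reach the values of each B-linear h : N → End_A(N). For fixed m,
the map n ↦ h(n)(m) comes from some F m : C → A; letting m vary assembles these into a map C → *N
whose image under `can` is sent to h by `dualEval`. -/
theorem dualEval_surjective (hG : IsContraGalois A C B N)
    (hGen : IsSeparator (ModuleCat.of Bᵐᵒᵖ N)) : Function.Surjective (dualEval A N B) := by
  rw [← LinearMap.range_eq_top, eq_top_iff]
  refine le_of_isSeparator hGen _ _ fun h _ n₀ => ?_
  -- The Galois condition is applied at X = A, with N embedded in A ⊗_A N as 1 ⊗ n.
  have hex : ∀ m : N, ∃ f : HomR A C A, ∀ n,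
      can A C B N A f n = BTensor.tmul A (1 : A) (h n m) := fun m =>
    hG.exists_can_eq
      { toFun := fun n => BTensor.tmul A (1 : A) (h n m)
        map_add' := fun n n' => by rw [map_add, LinearMap.add_apply, BTensor.tmul_add]
        map_smul' := fun b n => by rw [map_smul]; rfl }
  choose F hF using hex
  let f : HomR A C (LeftDual A N) :=
    { toFun := fun c =>
        ({ toFun := fun m => (F m).lin c
           map_add' := fun m m' => by
            -- The choice of F m is unique because `can` is injective; this makes F additive and,
            -- below, left A-linear in m.
            have : F (m + m') = F m + F m' := hG.hom_ext fun n => by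
              rw [map_add, LinearMap.add_apply, hF, hF, hF, map_add, BTensor.tmul_add]
            rw [this]; rfl
           map_smul' := fun a m => by
            have : F (a • m) = HomR.postcomp (BTensor.leftMul A A a) (F m) :=
              hG.hom_ext fun n => by
                rw [can_postcomp, hF, hF, BTensor.map_tmul, map_smul, ← BTensor.balanced]
                simp [BTensor.leftMul]
            rw [this]; rfl } : N →ₗ[A] A)
      map_add' := fun c d => LeftDual.ext fun m => map_add (F m).lin c d
      map_smul' := fun a c => LeftDual.ext fun m => map_smul (F m).lin a c }
  refine ⟨can A C B N _ f n₀, LinearMap.ext fun m => ?_⟩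
  have key : ∀ t : BTensor A C N, dualEval A N B (BTensor.map f.lin LinearMap.id t) m =
      BTensor.lid A N (BTensor.map (F m).lin LinearMap.id t) := by
    intro t
    induction t using BTensor.induction_on with
    | zero => simp only [map_zero, LinearMap.zero_apply]
    | tmul c n => rfl
    | add x y hx hy => simp only [map_add, LinearMap.add_apply, hx, hy]
  rw [can_apply, key, ← can_apply (B := B), hF, BTensor.lid_tmul, one_smul]

/-- Preservation of exactness needs only the dual basis. Reflection tests on maps out of the
generator C, which `can` turns into maps out of N with values in the tensored sequence. -/
theorem isFaithfullyFlat (hG : IsContraGalois A C B N) [Module.Projective Bᵐᵒᵖ N]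
    (e : DualBasis A N) (hC : IsSeparator (ModuleCat.of Aᵐᵒᵖ C)) : IsFaithfullyFlat A N := by
  intro X Y Z f g
  constructor
  · intro h t
    constructor
    · intro ht
      have hy : ∀ i, ∃ x, f x = BTensor.contract (e.covec i) t := fun i => (h _).1 (by
        rw [← BTensor.contract_map, ht, map_zero])
      choose x hx using hy
      refine ⟨∑ i, BTensor.tmul A (x i) (e.vec i), ?_⟩
      simp only [map_sum, BTensor.map_tmul, hx, LinearMap.id_apply, BTensor.sum_tmul_contract]
    · rintro ⟨s, rfl⟩
      rw [BTensor.map_map, h.linearMap_comp_eq_zero, BTensor.map_zero_left]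
  · intro h
    have hgf : g ∘ₗ f = 0 := by
      rw [← LinearMap.ker_eq_top, eq_top_iff]
      refine le_of_isSeparator hC _ _ fun φ _ c => ?_
      have h0 : HomR.postcomp (g ∘ₗ f) (HomR.ofLin φ) = 0 := hG.hom_ext fun n => by
        have h₁ := (h (BTensor.map f LinearMap.id (can A C B N X (HomR.ofLin φ) n))).2 ⟨_, rfl⟩
        rw [BTensor.map_map, LinearMap.id_comp] at h₁
        rw [can_postcomp, h₁, map_zero, LinearMap.zero_apply]
      exact congrArg (fun k : HomR A C Z => k.lin c) h0
    refine fun y => ⟨fun hy => ?_, ?_⟩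
    · have hle : LinearMap.ker g ≤ LinearMap.range f := by
        -- A map φ from C into ker g has `can` φ in the kernel of g ⊗ N, which is the image of f ⊗
        -- N; hence φ itself lifts along f.
        refine le_of_isSeparator hC _ _ fun φ hφ c => ?_
        have h0 : HomR.postcomp g (HomR.ofLin φ) = 0 := HomR.ext hφ
        obtain ⟨k, hk⟩ := hG.exists_lift f (HomR.ofLin φ) fun n => (h _).1 (by
          rw [← can_postcomp, h0, map_zero, LinearMap.zero_apply])
        exact ⟨k.lin c, congrArg (fun k : HomR A C Y => k.lin c) hk⟩
      exact hle hy
    · rintro ⟨x, rfl⟩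
      exact LinearMap.congr_fun hgf x

end IsContraGalois

/-! ### Comparison of C with the comatrix coring -/

variable (A C B N) in
/-- The canonical map `N ⊗_B *N → C`, `n ⊗ φ ↦ (C ⊗_A φ)(ρ(n))`. -/
def comatrixMap : BimodHom A A (BTensor B N (LeftDual A N)) C where
  toFun := BTensor.lift (AddMonoidHom.mk'
      (fun n => AddMonoidHom.mk' (fun φ => BTensor.contract φ (coaction A C N n))
        (fun φ ψ => BTensor.contract_add φ ψ _))
      (fun n n' => AddMonoidHom.ext fun φ => by
        simp only [AddMonoidHom.mk'_apply, AddMonoidHom.add_apply, map_add]))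
    (fun n b φ => by
      simp only [AddMonoidHom.mk'_apply, IsBicomodule.coaction_op_smul]
      exact (BTensor.contract_smul_left b φ _).symm)
  map_add' := map_add _
  map_smul' a t := by
    induction t using BTensor.induction_on with
    | zero => simp only [smul_zero, map_zero]
    | tmul n φ =>
      change BTensor.contract φ (coaction A C N (a • n)) =
        a • BTensor.contract φ (coaction A C N n)
      rw [map_smul, BTensor.contract_smul]
    | add x y hx hy => simp only [smul_add, map_add, hx, hy]
  map_op_smul' a t := by
    induction t using BTensor.induction_on with
    | zero => simp only [smul_zero, map_zero]
    | tmul n φ => exact BTensor.contract_op_smul a φ (coaction A C N n)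
    | add x y hx hy => simp only [smul_add, map_add, hx, hy]

theorem comatrixMap_tmul (n : N) (φ : LeftDual A N) :
    (comatrixMap A C B N).left (BTensor.tmul B n φ) = BTensor.contract φ (coaction A C N n) := rfl

/-- Through contractions, `can` becomes precomposition with `comatrixMap`. -/
theorem contract_can {X : Type u} [AddCommGroup X] [Module Aᵐᵒᵖ X] (f : HomR A C X) (n : N)
    (φ : LeftDual A N) : BTensor.contract φ (can A C B N X f n) =
      f.lin ((comatrixMap A C B N).right (BTensor.tmul B n φ)) := by
  rw [can_apply, BTensor.contract_map]
  rfl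

/-- For a right `A`-linear map `u : N ⊗_B *N → X`, the map `N → X ⊗_A N`,
`n ↦ ∑ᵢ u(n ⊗ eᵢ*) ⊗ eᵢ`. -/
def DualBasis.curry (e : DualBasis A N) {X : Type u} [AddCommGroup X] [Module Aᵐᵒᵖ X]
    (u : BTensor B N (LeftDual A N) →ₗ[Aᵐᵒᵖ] X) : N →ₗ[Bᵐᵒᵖ] BTensor A X N where
  toFun n := ∑ i, BTensor.tmul A (u (BTensor.tmul B n (e.covec i))) (e.vec i)
  map_add' n n' := by
    simp only [BTensor.add_tmul, map_add, Finset.sum_add_distrib]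
  map_smul' b n := by
    -- B-linearity is the identity ∑ eᵢ* ⊗ eᵢ b = ∑ b eᵢ* ⊗ eᵢ in *N ⊗_A N, pushed forward along v ⊗
    -- N.
    let v : LeftDual A N →ₗ[Aᵐᵒᵖ] X :=
      { toFun := fun φ => u (BTensor.tmul B n φ)
        map_add' := fun φ ψ => by rw [BTensor.tmul_add, map_add]
        map_smul' := fun a φ => by rw [← BTensor.op_smul_tmul, map_smul]; rfl }
    have h := congrArg (BTensor.map v LinearMap.id) (e.smul_comm_tmul B (unop b))
    rw [map_sum, map_sum] at h
    rw [RingHom.id_apply, Finset.smul_sum]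
    refine Eq.trans (Finset.sum_congr rfl fun i _ => ?_) h.symm
    exact congrArg (fun s => BTensor.tmul A (u s) (e.vec i))
      (BTensor.balanced n (unop b) (e.covec i))

theorem DualBasis.curry_apply (e : DualBasis A N) {X : Type u} [AddCommGroup X] [Module Aᵐᵒᵖ X]
    (u : BTensor B N (LeftDual A N) →ₗ[Aᵐᵒᵖ] X) (n : N) :
    e.curry u n = ∑ i, BTensor.tmul A (u (BTensor.tmul B n (e.covec i))) (e.vec i) := rfl

theorem DualBasis.sum_op_smul_covec (e : DualBasis A N) (φ : LeftDual A N) :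
    ∑ i, op (φ.lin (e.vec i)) • e.covec i = φ := by
  ext m
  rw [LeftDual.sum_lin]
  conv_rhs => rw [← e.sum_eq m, map_sum]
  refine Finset.sum_congr rfl fun i _ => ?_
  rw [LeftDual.op_smul_lin, unop_op, map_smul, smul_eq_mul]

/-- Expanding φ as ∑ eᵢ* φ(eᵢ) shows that contraction recovers u from its curried form. -/
theorem DualBasis.contract_curry (e : DualBasis A N) {X : Type u} [AddCommGroup X]
    [Module Aᵐᵒᵖ X] (u : BTensor B N (LeftDual A N) →ₗ[Aᵐᵒᵖ] X) (n : N) (φ : LeftDual A N) :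
    BTensor.contract φ (e.curry u n) = u (BTensor.tmul B n φ) := by
  conv_rhs => rw [← e.sum_op_smul_covec φ, BTensor.tmul_sum, map_sum]
  rw [e.curry_apply, map_sum]
  refine Finset.sum_congr rfl fun i _ => ?_
  rw [BTensor.contract_tmul, ← BTensor.op_smul_tmul, map_smul]

/-- The contractions of `can` f determine f and see it only on the image of `comatrixMap`, so
`comatrixMap` can be cancelled on the right. -/
theorem IsContraGalois.ext_comatrixMap (hG : IsContraGalois A C B N) (e : DualBasis A N)
    {X : Type u} [AddCommGroup X] [Module Aᵐᵒᵖ X] {f g : HomR A C X}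
    (h : f.lin ∘ₗ (comatrixMap A C B N).right = g.lin ∘ₗ (comatrixMap A C B N).right) :
    f = g := by
  refine hG.hom_ext fun n => ?_
  rw [← BTensor.sum_tmul_contract e (can A C B N X f n),
    ← BTensor.sum_tmul_contract e (can A C B N X g n)]
  simp only [contract_can]
  exact Finset.sum_congr rfl fun i _ =>
    congrArg (fun x => BTensor.tmul A x (e.vec i)) (LinearMap.congr_fun h _)

/-- Yoneda: currying the identity of N ⊗_B *N and inverting `can` produces the candidate inverse g.
-/
theorem IsContraGalois.bijective_comatrixMap (hG : IsContraGalois A C B N) (e : DualBasis A N) :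
    Function.Bijective (comatrixMap A C B N).left := by
  obtain ⟨g, hg⟩ := hG.exists_can_eq
    (e.curry (LinearMap.id : BTensor B N (LeftDual A N) →ₗ[Aᵐᵒᵖ] _))
  have h₁ : ∀ t, g.lin ((comatrixMap A C B N).right t) = t := by
    intro t
    induction t using BTensor.induction_on with
    | zero => simp only [map_zero]
    | tmul n φ => rw [← contract_can, hg, e.contract_curry, LinearMap.id_apply]
    | add x y hx hy => rw [map_add, map_add, hx, hy]
  -- For γ = `comatrixMap`, the relation gγ = id gives γgγ = γ, and γ cancels on the right.
  have h₂ : HomR.postcomp (comatrixMap A C B N).right g = (LinearMap.id : C →ₗ[Aᵐᵒᵖ] C) :=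
    hG.ext_comatrixMap e (LinearMap.ext fun t => congrArg (comatrixMap A C B N).right (h₁ t))
  exact Function.bijective_iff_has_inverse.2 ⟨g.lin, h₁,
    fun c => congrArg (fun k : HomR A C C => k.lin c) h₂⟩

theorem counit_comatrixMap (t : BTensor B N (LeftDual A N)) :
    (Coring.counit : BimodHom A A C A).left ((comatrixMap A C B N).left t) =
      comatrixCounit B t := by
  induction t using BTensor.induction_on with
  | zero => simp only [map_zero]
  | tmul n φ =>
    rw [comatrixMap_tmul, comatrixCounit_tmul]
    conv_rhs => rw [← LeftComodule.counit (C := C) (A := A) n]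
    change _ = φ.lin (BTensor.lid A N (BTensor.map _ _ (coaction A C N n)))
    generalize coaction A C N n = t
    induction t using BTensor.induction_on with
    | zero => simp only [map_zero]
    | tmul c m =>
      rw [BTensor.contract_tmul, BTensor.map_tmul, BTensor.lid_tmul, map_smul φ.lin,
        ← BimodHom.right_apply, map_smul]
      rfl
    | add x y hx hy => simp only [map_add, hx, hy]
  | add x y hx hy => simp only [map_add, hx, hy]

/-- Put w = (C ⊗ φ) ∘ ρ. Coassociativity turns the left side into (C ⊗ w)(ρ(n)), and the right side
agrees by expanding the second leg of ρ(n) in the dual basis. -/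
theorem comul_comatrixMap (e : DualBasis A N) (t : BTensor B N (LeftDual A N)) :
    (Coring.comul : BimodHom A A C (BTensor A C C)).left ((comatrixMap A C B N).left t) =
      BTensor.map (comatrixMap A C B N).right (comatrixMap A C B N).left
        (comatrixComul B e t) := by
  induction t using BTensor.induction_on with
  | zero => simp only [map_zero]
  | tmul n φ =>
    have h₁ : ∀ s : BTensor A C N, (Coring.comul : BimodHom A A C (BTensor A C C)).left
        (BTensor.contract φ s) = BTensor.map LinearMap.id
          (BTensor.contractLeft A φ)
          (BTensor.assoc A A C C N (BTensor.map
            (Coring.comul : BimodHom A A C (BTensor A C C)).right LinearMap.id s)) := by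
      intro s
      induction s using BTensor.induction_on with
      | zero => simp only [map_zero]
      | tmul c m =>
        rw [BTensor.contract_tmul, BTensor.map_tmul, BimodHom.right_apply,
          ← BimodHom.right_apply, map_smul, BimodHom.right_apply]
        generalize (Coring.comul : BimodHom A A C (BTensor A C C)).left c = r
        induction r using BTensor.induction_on with
        | zero => rw [smul_zero, BTensor.zero_tmul]; simp only [map_zero]
        | tmul c d => rfl
        | add x y hx hy => rw [smul_add, hx, hy, BTensor.add_tmul, map_add, map_add]
      | add x y hx hy => simp only [map_add, hx, hy]
    have h₂ := LeftComodule.coassoc (A := A) (C := C) n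
    change BTensor.assoc A A C C N (BTensor.map _ _ (coaction A C N n)) =
      BTensor.map _ (coaction A C N) (coaction A C N n) at h₂
    rw [comatrixMap_tmul, h₁, h₂, BTensor.map_map, comatrixComul_tmul]
    simp only [map_sum, BTensor.map_tmul, BimodHom.right_apply, comatrixMap_tmul]
    generalize coaction A C N n = s
    induction s using BTensor.induction_on with
    | zero => simp only [map_zero, BTensor.zero_tmul, Finset.sum_const_zero]
    | tmul c m =>
      simp only [BTensor.contract_tmul, BTensor.balanced]
      rw [← BTensor.tmul_sum]
      refine congrArg (BTensor.tmul A c) ?_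
      change (BTensor.contractLeft A φ ∘ₗ coaction A C N) m =
        ∑ i, (e.covec i).lin m • (BTensor.contractLeft A φ ∘ₗ coaction A C N) (e.vec i)
      simp only [← map_smul]
      rw [← map_sum, e.sum_eq]
    | add x y hx hy => simp only [map_add, BTensor.add_tmul, Finset.sum_add_distrib, hx, hy]
  | add x y hx hy => simp only [map_add, hx, hy]

end Galois

/-! ### Inverting a bijective coring homomorphism -/

section CoringIso

variable {A : Type*} [Ring A] {C D : Type*}
  [AddCommGroup C] [Module A C] [Module Aᵐᵒᵖ C] [SMulCommClass A Aᵐᵒᵖ C] [Coring A C]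
  [AddCommGroup D] [Module A D] [Module Aᵐᵒᵖ D] [SMulCommClass A Aᵐᵒᵖ D] [Coring A D]

/-- The inverse of a bijective coring homomorphism is a coring isomorphism. -/
theorem CoringIso.nonempty_of_bijective (γ : BimodHom A A D C) (hγ : Function.Bijective γ.left)
    (hε : ∀ d : D, (Coring.counit : BimodHom A A C A).left (γ.left d) =
      (Coring.counit : BimodHom A A D A).left d)
    (hΔ : ∀ d : D, (Coring.comul : BimodHom A A C (BTensor A C C)).left (γ.left d) =
      BTensor.map γ.right γ.left ((Coring.comul : BimodHom A A D (BTensor A D D)).left d)) :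
    Nonempty (CoringIso A C D) := by
  let l := LinearEquiv.ofBijective γ.left hγ
  let δ : BimodHom A A C D :=
    { l.symm.toLinearMap with
      map_op_smul' := fun a c => by
        change l.symm (a • c) = a • l.symm c
        rw [LinearEquiv.symm_apply_eq]
        change a • c = γ.right (a • l.symm c)
        rw [map_smul]
        exact congrArg (a • ·) (l.apply_symm_apply c).symm }
  have hγδ : ∀ c, γ.left (δ.left c) = c := l.apply_symm_apply
  have hδγ : ∀ d, δ.left (γ.left d) = d := l.symm_apply_apply
  refine ⟨⟨δ, l.symm.bijective, fun c => ?_, fun c => ?_⟩⟩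
  · rw [← hε, hγδ]
  · conv_rhs => rw [← hγδ c, hΔ, BTensor.map_map]
    have h₁ : δ.right ∘ₗ γ.right = LinearMap.id := LinearMap.ext hδγ
    have h₂ : δ.left ∘ₗ γ.left = LinearMap.id := LinearMap.ext hδγ
    rw [h₁, h₂, BTensor.map_id]

end CoringIso

/-! ### The endomorphism ring of the comodule N -/

section Subring

variable {A : Type u} [Ring A] {C : Type u} [AddCommGroup C] [Module A C]
    [Module Aᵐᵒᵖ C] [SMulCommClass A Aᵐᵒᵖ C] [Coring A C]
    {N : Type u} [AddCommGroup N] [Module A N] [LeftComodule A C N] {B : Subring (EndC A C N)}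

/-- A double centraliser argument: t ∈ T commutes with all B-endomorphisms of N, and a generator N
has enough of these to force t to act as an element of B. -/
theorem IsContraGalois.bijective_subtype (hG : IsContraGalois A C B N)
    (hGen : IsSeparator (ModuleCat.of (↥B)ᵐᵒᵖ N)) : Function.Bijective B.subtype := by
  refine ⟨Subtype.val_injective, fun t => ?_⟩
  have hcomm : ∀ (s : N →ₗ[(↥B)ᵐᵒᵖ] N) (n : N), t.unop.1 (s n) = s (t.unop.1 n) := by
    intro s n
    -- At X = A the Galois condition writes s as n ↦ (f ⊗ N)(ρ(n)) in A ⊗_A N = N, an expression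
    -- with which comodule endomorphisms commute.
    obtain ⟨f, hf⟩ := hG.exists_can_eq (X := A)
      { toFun := fun n => BTensor.tmul A (1 : A) (s n)
        map_add' := fun n n' => by rw [map_add, BTensor.tmul_add]
        map_smul' := fun b n => by rw [map_smul]; rfl }
    have hs : ∀ n, s n = BTensor.lid A N (can A C B N A f n) := fun n => by
      rw [hf]; exact (one_smul A (s n)).symm
    rw [hs, hs, can_apply, can_apply, t.unop.2 n, BTensor.map_map, ← BTensor.lid_map,
      BTensor.map_map]
    rfl
  have h1 : (1 : B) ∈ ⨆ g : N →ₗ[(↥B)ᵐᵒᵖ] B, LinearMap.range g := by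
    rw [iSup_range_eq_top_of_isSeparator hGen B]
    exact Submodule.mem_top
  obtain ⟨b, hb⟩ : ∃ b : B, ∀ x : N, t.unop.1 (op (1 : B) • x) = op b • x := by
    -- The claim is proved for every c₀ in the sum of the images of maps g : N → B. For c₀ = g(n),
    -- the B-endomorphism m ↦ x g(m) commutes with t, so t(x g(n)) = x g(t n) and b = g(t n).
    generalize (1 : B) = c₀ at h1 ⊢
    induction h1 using Submodule.iSup_induction' with
    | mem g c hc =>
      obtain ⟨n, rfl⟩ := hc
      refine ⟨g (t.unop.1 n), fun x => hcomm
        { toFun := fun m => op (g m) • x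
          map_add' := fun m m' => by rw [map_add, MulOpposite.op_add, add_smul]
          map_smul' := fun b m => by
            rw [map_smul, RingHom.id_apply, ← mul_smul]; rfl } n⟩
    | zero => exact ⟨0, fun x => by rw [MulOpposite.op_zero, zero_smul, map_zero]⟩
    | add c c' _ _ hc hc' =>
      obtain ⟨b, hb⟩ := hc
      obtain ⟨b', hb'⟩ := hc'
      exact ⟨b + b', fun x => by
        rw [MulOpposite.op_add, MulOpposite.op_add, add_smul, add_smul, map_add, hb, hb']⟩
  refine ⟨b, ?_⟩
  apply MulOpposite.unop_injective
  refine Subtype.ext (LinearMap.ext fun x => ?_)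
  have := hb x
  rw [MulOpposite.op_one, one_smul] at this
  exact this.symm

end Subring

/-! ### The contramodules Hom_B(N, V) and the counit of the adjunction -/

section HomContramodule

variable {A : Type u} [Ring A] {C : Type u} [AddCommGroup C] [Module A C] [Module Aᵐᵒᵖ C]
  [SMulCommClass A Aᵐᵒᵖ C] [Coring A C] {B : Type u} [Ring B] {N : Type u} [AddCommGroup N]
  [Module A N] [Module Bᵐᵒᵖ N] [SMulCommClass A Bᵐᵒᵖ N] [LeftComodule A C N]
  [IsBicomodule A C B N]

variable (A B N) in
/-- `Hom_B(N, V)`, a right `A`-module by `(f · a) n = f (a n)`. -/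
def HomB (V : Type u) [AddCommGroup V] [Module Bᵐᵒᵖ V] : Type u := N →ₗ[Bᵐᵒᵖ] V

namespace HomB

variable {V : Type u} [AddCommGroup V] [Module Bᵐᵒᵖ V]

instance : AddCommGroup (HomB B N V) := inferInstanceAs (AddCommGroup (N →ₗ[Bᵐᵒᵖ] V))

/-- The underlying linear map. -/
def lin (f : HomB B N V) : N →ₗ[Bᵐᵒᵖ] V := f

@[ext]
theorem ext {f g : HomB B N V} (h : ∀ n, f.lin n = g.lin n) : f = g := LinearMap.ext h

/-- Left multiplication by `a`, as a right `B`-linear map. -/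
def lsmul (B : Type u) [Ring B] (N : Type u) [AddCommGroup N] [Module A N] [Module Bᵐᵒᵖ N]
    [SMulCommClass A Bᵐᵒᵖ N] (a : A) : N →ₗ[Bᵐᵒᵖ] N where
  toFun n := a • n
  map_add' := smul_add a
  map_smul' b n := smul_comm a b n

instance : Module Aᵐᵒᵖ (HomB B N V) where
  smul a f := f.lin ∘ₗ lsmul B N (unop a)
  one_smul f := ext fun n => congrArg f.lin (one_smul A n)
  mul_smul a b f := ext fun n => congrArg f.lin (mul_smul (unop b) (unop a) n)
  smul_zero a := rfl
  smul_add a f g := rfl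
  add_smul a b f := ext fun n =>
    (congrArg f.lin (add_smul (unop a) (unop b) n)).trans (map_add f.lin _ _)
  zero_smul f := ext fun n => (congrArg f.lin (zero_smul A n)).trans (map_zero f.lin)

variable (A B N V) in
/-- The evaluation `Hom_B(N, V) ⊗_A N → V`. -/
def eval : BTensor A (HomB B N V) N →ₗ[Bᵐᵒᵖ] V where
  toFun := BTensor.lift (AddMonoidHom.mk' (fun f => f.lin.toAddMonoidHom) (fun f g => rfl))
    (fun f a n => rfl)
  map_add' := map_add _
  map_smul' b t := by
    induction t using BTensor.induction_on with
    | zero => simp only [smul_zero, map_zero]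
    | tmul f n => exact map_smul f.lin b n
    | add x y hx hy => simp only [smul_add, map_add, hx, hy]

theorem eval_tmul (f : HomB B N V) (n : N) : eval A B N V (BTensor.tmul A f n) = f.lin n := rfl

variable (A C B N V) in
/-- The contraaction `[C, Hom_B(N, V)] → Hom_B(N, V)`: apply the canonical map and evaluate. -/
def contraAct : HomR A C (HomB B N V) →ₗ[Aᵐᵒᵖ] HomB B N V where
  toFun f := eval A B N V ∘ₗ can A C B N _ f
  map_add' f g := by
    rw [map_add, LinearMap.comp_add]
    rfl
  map_smul' a f := ext fun n => congrArg (eval A B N V) (can_op_smul f (unop a) n)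

theorem contraAct_lin (f : HomR A C (HomB B N V)) (n : N) :
    (contraAct A C B N V f).lin n = eval A B N V (can A C B N _ f n) := rfl

theorem eval_map_contraAct (t : BTensor A (HomR A C (HomB B N V)) N) :
    eval A B N V (BTensor.map (contraAct A C B N V) LinearMap.id t) =
      eval A B N V (canTensor A C B N _ t) := by
  induction t using BTensor.induction_on with
  | zero => simp only [map_zero]
  | tmul f n => rfl
  | add x y hx hy => simp only [map_add, hx, hy]

/-- Associativity of the contraaction reduces to `canTensor_can`, both sides being evaluations of
the same tensor. -/
theorem contraAct_mult (h : HomR A C (HomR A C (HomB B N V))) :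
    contraAct A C B N V (HomR.mult A C _ h) =
      contraAct A C B N V (HomR.postcomp (contraAct A C B N V) h) := ext fun n => by
  rw [contraAct_lin, contraAct_lin, can_postcomp, eval_map_contraAct, canTensor_can]

variable (A C B N) in
/-- The contramodule `Hom_B(N, V)`. -/
def contramodule (V : Type u) [AddCommGroup V] [Module Bᵐᵒᵖ V] : Contramodule A C where
  A := ModuleCat.of Aᵐᵒᵖ (HomB B N V)
  a := ModuleCat.ofHom (contraAct A C B N V)
  unit := ModuleCat.hom_ext (LinearMap.ext fun f => ext fun n => by
    change (contraAct A C B N V (HomR.unit A C _ f)).lin n = f.lin n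
    rw [contraAct_lin, can_unit, eval_tmul])
  assoc := ModuleCat.hom_ext (LinearMap.ext fun h => contraAct_mult h)

variable (A C B N V) in
/-- The relations defining `Hom_B(N, V) ⊗_{[C,-]} N`. -/
def rel : Submodule Bᵐᵒᵖ (BTensor A (HomB B N V) N) :=
  contraRel B N (contramodule A C B N V)

theorem rel_eq_span : rel A C B N V = Submodule.span Bᵐᵒᵖ {t | ∃ (f : HomR A C (HomB B N V))
    (n : N), t = can A C B N _ f n - BTensor.tmul A (contraAct A C B N V f) n} := rfl

/-- A map N → ker(`eval`) equals `can` f for some f, and the contraaction kills this f. Each value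
`can` f n is therefore a defining relation, and such values exhaust the kernel because N generates.
-/
theorem rel_eq_ker_eval (hG : IsContraGalois A C B N)
    (hGen : IsSeparator (ModuleCat.of Bᵐᵒᵖ N)) :
    rel A C B N V = LinearMap.ker (eval A B N V) := by
  rw [rel_eq_span]
  refine le_antisymm ?_ (le_of_isSeparator hGen _ _ fun h hh n => ?_)
  · rw [Submodule.span_le]
    rintro _ ⟨f, n, rfl⟩
    exact (map_sub (eval A B N V) _ _).trans (sub_self _)
  · obtain ⟨f, hf⟩ := hG.exists_can_eq h
    have h0 : contraAct A C B N V f = 0 := ext fun n => by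
      rw [contraAct_lin, hf]
      exact hh n
    exact Submodule.subset_span ⟨f, n, by rw [h0, BTensor.zero_tmul, hf, sub_zero]⟩

theorem eval_surjective (hGen : IsSeparator (ModuleCat.of Bᵐᵒᵖ N)) :
    Function.Surjective (eval A B N V) := by
  rw [← LinearMap.range_eq_top, eq_top_iff]
  exact le_of_isSeparator hGen _ _ fun h _ n => ⟨BTensor.tmul A (h : HomB B N V) n, rfl⟩

/-- Evaluation identifies `Hom_B(N, V) ⊗_{[C,-]} N` with `V`. -/
noncomputable def contraTensorEquiv (hG : IsContraGalois A C B N)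
    (hGen : IsSeparator (ModuleCat.of Bᵐᵒᵖ N)) :
    (BTensor A (HomB B N V) N ⧸ rel A C B N V) ≃ₗ[Bᵐᵒᵖ] V :=
  (Submodule.quotEquivOfEq _ _ (rel_eq_ker_eval hG hGen)).trans
    ((eval A B N V).quotKerEquivOfSurjective (eval_surjective hGen))

end HomB

/-! ### The unit of the adjunction and the equivalence -/

section Unit

variable (B N) in
/-- The unit `M → Hom_B(N, M ⊗_{[C,-]} N)`. -/
def contraUnit (M : Contramodule A C) : M.A →ₗ[Aᵐᵒᵖ] HomB B N (ContraTensor B N M) where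
  toFun m := (contraRel B N M).mkQ ∘ₗ
    { toFun := fun n => BTensor.tmul A m n
      map_add' := BTensor.tmul_add m
      map_smul' := fun b n => rfl }
  map_add' m m' := HomB.ext fun n =>
    (congrArg (contraRel B N M).mkQ (BTensor.add_tmul m m' n)).trans (map_add _ _ _)
  map_smul' a m := HomB.ext fun n =>
    congrArg (contraRel B N M).mkQ (BTensor.balanced m (unop a) n)

theorem contraUnit_lin (M : Contramodule A C) (m : M.A) (n : N) :
    (contraUnit B N M m).lin n = (contraRel B N M).mkQ (BTensor.tmul A m n) := rfl

theorem Contramodule.act_unit (M : Contramodule A C) (m : M.A) :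
    M.act (HomR.unit A C M.A m) = m :=
  congrArg (fun k : M.A ⟶ M.A => k.hom m) M.unit

theorem Contramodule.act_mult (M : Contramodule A C) (h : HomR A C (HomR A C M.A)) :
    M.act (HomR.mult A C M.A h) = M.act (HomR.postcomp M.act h) :=
  congrArg (fun k => k.hom h) M.assoc

theorem mkQ_can (M : Contramodule A C) (f : HomR A C M.A) (n : N) :
    (contraRel B N M).mkQ (can A C B N M.A f n) =
      (contraRel B N M).mkQ (BTensor.tmul A (M.act f) n) := by
  rw [← sub_eq_zero, ← map_sub, Submodule.mkQ_apply, Submodule.Quotient.mk_eq_zero]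
  exact Submodule.subset_span ⟨f, n, rfl⟩

/-- This exhibits the relations as values of a single B-linear map, against which maps out of the
projective module N can be lifted. -/
theorem contraRel_le_range (M : Contramodule A C) :
    contraRel B N M ≤
      LinearMap.range (canTensor A C B N M.A - BTensor.mapRight B N M.act) := by
  rw [contraRel, Submodule.span_le]
  rintro _ ⟨f, n, rfl⟩
  exact ⟨BTensor.tmul A f n, rfl⟩

/-- In both halves, projectivity lifts a map out of N and the Galois condition reads the lift as an
element of [C, -], to which the contraaction is applied. -/
theorem contraUnit_bijective (hG : IsContraGalois A C B N) [Module.Projective Bᵐᵒᵖ N]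
    (M : Contramodule A C) : Function.Bijective (contraUnit B N M) := by
  constructor
  · rw [← LinearMap.ker_eq_bot, LinearMap.ker_eq_bot']
    intro m hm
    let θ := canTensor A C B N M.A - BTensor.mapRight B N M.act
    -- If m maps to 0, then every m ⊗ n is a relation, so n ↦ m ⊗ n, which is `can` of the unit at
    -- m, lifts through θ.
    obtain ⟨l, hl⟩ := Module.projective_lifting_property θ.rangeRestrict
      ((can A C B N M.A (HomR.unit A C M.A m)).codRestrict (LinearMap.range θ) fun n => by
        refine contraRel_le_range M ?_
        rw [can_unit, ← Submodule.Quotient.mk_eq_zero, ← Submodule.mkQ_apply, ← contraUnit_lin, hm]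
        rfl)
      (LinearMap.surjective_rangeRestrict _)
    obtain ⟨h, hh⟩ := hG.exists_can_eq l
    have key : HomR.unit A C M.A m = HomR.mult A C M.A h - HomR.postcomp M.act h :=
      hG.hom_ext fun n => by
        have h₁ : θ (l n) = can A C B N M.A (HomR.unit A C M.A m) n :=
          congrArg Subtype.val (LinearMap.congr_fun hl n)
        rw [← h₁, ← hh, map_sub, LinearMap.sub_apply, LinearMap.sub_apply, can_postcomp,
          ← canTensor_can]
        rfl
    -- The contraaction sends the unit at m to m, and by associativity takes equal values on the two
    -- terms of the difference.
    rw [← M.act_unit m, key, map_sub, M.act_mult, sub_self]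
  · intro k
    obtain ⟨l, hl⟩ := Module.projective_lifting_property (contraRel B N M).mkQ k.lin
      (Submodule.mkQ_surjective _)
    obtain ⟨f, hf⟩ := hG.exists_can_eq l
    refine ⟨M.act f, HomB.ext fun n => ?_⟩
    rw [contraUnit_lin, ← mkQ_can, hf]
    exact LinearMap.congr_fun hl n

theorem contraTensorMap_contraUnit {M M' : Contramodule A C} (g : M ⟶ M') (m : M.A) (n : N) :
    contraTensorMap B N g ((contraUnit B N M m).lin n) =
      (contraUnit B N M' (g.f.hom m)).lin n := rfl

theorem contraTensorFunctor_faithful (hG : IsContraGalois A C B N)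
    [Module.Projective Bᵐᵒᵖ N] : (contraTensorFunctor A C B N).Faithful where
  map_injective {M M'} g g' h := by
    refine Monad.Algebra.Hom.ext (ModuleCat.hom_ext (LinearMap.ext fun m => ?_))
    refine (contraUnit_bijective (B := B) (N := N) hG M').1 (HomB.ext fun n => ?_)
    rw [← contraTensorMap_contraUnit, ← contraTensorMap_contraUnit]
    exact congrArg (fun k => k.hom ((contraUnit B N M m).lin n)) h

/-- The preimage of k is Hom_B(N, k) transported along the unit isomorphisms; only its compatibility
with the contraactions needs an argument. -/
theorem contraTensorFunctor_full (hG : IsContraGalois A C B N)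
    [Module.Projective Bᵐᵒᵖ N] : (contraTensorFunctor A C B N).Full where
  map_surjective {M M'} k := by
    let k' : ContraTensor B N M →ₗ[Bᵐᵒᵖ] ContraTensor B N M' := k.hom
    let η := LinearEquiv.ofBijective _ (contraUnit_bijective (B := B) (N := N) hG M')
    let K : HomB B N (ContraTensor B N M) →ₗ[Aᵐᵒᵖ] HomB B N (ContraTensor B N M') :=
      { toFun := fun f => k' ∘ₗ f.lin
        map_add' := fun f g => HomB.ext fun n => map_add k' _ _
        map_smul' := fun a f => rfl }
    let g : M.A →ₗ[Aᵐᵒᵖ] M'.A := η.symm.toLinearMap ∘ₗ K ∘ₗ contraUnit B N M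
    have hg : ∀ m n, (contraRel B N M').mkQ (BTensor.tmul A (g m) n) =
        k' ((contraRel B N M).mkQ (BTensor.tmul A m n)) := fun m n =>
      congrArg (fun f : HomB B N (ContraTensor B N M') => f.lin n)
        (η.apply_symm_apply (K (contraUnit B N M m)))
    have hg' : ∀ t : BTensor A M.A N, (contraRel B N M').mkQ (BTensor.map g LinearMap.id t) =
        k' ((contraRel B N M).mkQ t) := by
      intro t
      induction t using BTensor.induction_on with
      | zero => simp only [map_zero]
      | tmul m n => exact hg m n
      | add x y hx hy => simp only [map_add, hx, hy]
    -- Injectivity of the unit of M' allows the check in M' ⊗_{[C,-]} N, where a contraaction may be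
    -- exchanged for `can` by `mkQ_can`.
    have hact : ∀ f : HomR A C M.A, M'.act (HomR.postcomp g f) = g (M.act f) := fun f =>
      (contraUnit_bijective (B := B) (N := N) hG M').1 (HomB.ext fun n => by
        rw [contraUnit_lin, contraUnit_lin, ← mkQ_can, can_postcomp, hg, hg', mkQ_can])
    refine ⟨{ f := ModuleCat.ofHom g, h := ModuleCat.hom_ext (LinearMap.ext hact) }, ?_⟩
    refine ModuleCat.hom_ext (LinearMap.ext fun t => ?_)
    obtain ⟨t, rfl⟩ := Submodule.Quotient.mk_surjective _ t
    exact hg' t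

theorem contraTensorFunctor_essSurj (hG : IsContraGalois A C B N)
    (hGen : IsSeparator (ModuleCat.of Bᵐᵒᵖ N)) : (contraTensorFunctor A C B N).EssSurj where
  mem_essImage V := ⟨HomB.contramodule A C B N V,
    ⟨(HomB.contraTensorEquiv (V := V) hG hGen).toModuleIso⟩⟩

theorem contraTensorFunctor_isEquivalence (hG : IsContraGalois A C B N)
    [Module.Projective Bᵐᵒᵖ N] (hGen : IsSeparator (ModuleCat.of Bᵐᵒᵖ N)) :
    (contraTensorFunctor A C B N).IsEquivalence where
  faithful := contraTensorFunctor_faithful hG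
  full := contraTensorFunctor_full hG
  essSurj := contraTensorFunctor_essSurj hG hGen

end Unit

end HomContramodule

end ContraGalois

/-! ### Main theorem -/

theorem mainTheorem4 {A : Type u} [Ring A] {C : Type u} [AddCommGroup C] [Module A C]
    [Module Aᵐᵒᵖ C] [SMulCommClass A Aᵐᵒᵖ C] [Coring A C]
    {N : Type u} [AddCommGroup N] [Module A N] [LeftComodule A C N]
    (B : Subring (EndC A C N))
    (hGalois : IsContraGalois A C B N)
    (hProj : Module.Projective (↥B)ᵐᵒᵖ N)
    (hGen : CategoryTheory.IsSeparator (ModuleCat.of (↥B)ᵐᵒᵖ N)) :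
    (contraTensorFunctor A C B N).IsEquivalence ∧
    Module.Projective Aᵐᵒᵖ C ∧
    (∃ (_ : Module.Finite A N) (_ : Module.Projective A N),
      Nonempty (CoringIso A C (BTensor B N (LeftDual A N)))) ∧
    Function.Bijective B.subtype ∧
    (CategoryTheory.IsSeparator (ModuleCat.of Aᵐᵒᵖ C) → IsFaithfullyFlat A N) := by
  obtain ⟨e⟩ := nonempty_dualBasis_of_dualEval_surjective B (hGalois.dualEval_surjective hGen)
  refine ⟨contraTensorFunctor_isEquivalence hGalois hGen, hGalois.projective,
    ⟨e.finite, e.projective, ?_⟩, hGalois.bijective_subtype hGen,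
    hGalois.isFaithfullyFlat e⟩
  have := e.finite
  have := e.projective
  -- Bijectivity may use any dual basis, but the comultiplication must be compared using the one
  -- chosen in `comatrixCoring`.
  exact CoringIso.nonempty_of_bijective (comatrixMap A C B N) (hGalois.bijective_comatrixMap e)
    counit_comatrixMap (comul_comatrixMap (Classical.choice (exists_dualBasis A N)))
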